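/- Let $k\ge 1$. An unnormalised $k$-partite pure state is a vector $|\psi\rangle\in\mathcal H_1\otimes\cdots\otimes\mathcal H_k$, where the $\mathcal H_j$ are finite-dimensional complex Hilbert spaces. Two such vectors $|\phi\rangle\in\bigotimes_j\mathcal H_j$ and $|\psi\rangle\in\bigotimes_j\mathcal H_j'$ are locally unitarily equivalent if there are partial isometries $U_j:\mathcal H_j\to\mathcal H_j'$ with $|\psi\rangle=(U_1\otimes\cdots\otimes U_k)|\phi\rangle$ and $|\phi\rangle=(U_1^*\otimes\cdots\otimes U_k^*)|\psi\rangle$. Let $\mathcal S_k$ be the set of equivalence classes. With the direct sum $|\psi\rangle\oplus|\phi\rangle\in\bigotimes_j(\mathcal H_j\oplus\mathcal H'_j)$, the tensor product $|\psi\rangle\otimes|\phi\rangle\in\bigotimes_j(\mathcal H_j\otimes\mathcal H'_j)$, the zero vector of $\mathbb C^{\otimes k}$ as $0$ and $|0\cdots0\rangle\in\mathbb C^{\otimes k}$ as $1$, it is a commutative semiring. A one-step LOCC channel maps operators on $\mathcal H_1\otimes\cdots\otimes\mathcal H_k\otimes\mathbb C^{\mathcal X}$ that are diagonal in the register $\mathbb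 C^{\mathcal X}$ ($\mathcal X$ a finite set) to operators of the same kind, with one space $\mathcal H_i$ replaced by $\mathcal H_i'$ and $\mathcal X$ by a finite set $\mathcal Y$. It has the form $\rho\mapsto\sum_{j\in J}\big((K_j)_i\otimes|g(j)\rangle\langle f(j)|\big)\rho\big((K_j^*)_i\otimes|f(j)\rangle\langle g(j)|\big)$, with $J$ finite, $f:J\to\mathcal X$, $g:J\to\mathcal Y$, linear maps $K_j:\mathcal H_i\to\mathcal H_i'$ acting on the $i$-th factor, and $\sum_{j\in J}K_j^*K_j\otimes|f(j)\rangle\langle f(j)|\le I$. An LOCC channel is a finite composition of these. Write $|\psi\rangle\to|\phi\rangle$ if some LOCC channel, with one-point initial and final registers, maps $|\psi\rangle\langle\psi|$ to $|\phi\rangle\langle\phi|$, and put $[\psi]\ge[\phi]$ if $|\psi\rangle\to|\phi\rangle$; this is a well-defined preorder on $\mathcal S_k$. Then: 1. $\mathcal S_k$ is a preordered semiring: if $a\le b$ and $c\le d$, then $a+c\le b+d$ and $ac\le bd$. 2. The image of $d\in\mathbb N$ in $\mathcal S_k$ is the class of $|\mathrm{GHZ}_d\rangle=\sum_{i=0}^{d-1}|i\cdots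 i\rangle\in(\mathbb C^d)^{\otimes k}$, and for $m,n\in\mathbb N$ one has $m\le n$ in $\mathcal S_k$ if and only if $m\le n$ in $\mathbb N$. For all $a,b\in\mathcal S_k\setminus\{0\}$ there is an $r\in\mathbb N$ with $a\le r\,b$. 3. Write $[\psi]\gtrsim[\phi]$ if there is a sequence of natural numbers $x_n\in o(n)$ with $[\phi]^n\le 2^{x_n}[\psi]^n$ for all $n$. Equivalently, for some such sequence, $|\mathrm{GHZ}_2\rangle^{\otimes x_n}\otimes|\psi\rangle^{\otimes n}\to|\phi\rangle^{\otimes n}$ for all $n$. 4. Let $\Delta(\mathcal S_k)$, the asymptotic LOCC spectrum, be the set of semiring homomorphisms $f:\mathcal S_k\to\mathbb R^+=[0,\infty)$ that are monotone ($a\le b$ implies $f(a)\le f(b)$). Then for all $|\psi\rangle,|\phi\rangle$: $$[\psi]\gtrsim[\phi]\iff f([\psi])\ge f([\phi])\ \text{ for all } f\in\Delta(\mathcal S_k).$$ -/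

import Mathlib

open scoped Matrix Kronecker NNReal ComplexOrder Asymptotics

noncomputable section

namespace LOCC

/-- Multi-indices labelling the product basis of `ℂ^{d 0} ⊗ ⋯ ⊗ ℂ^{d (k-1)}`. -/
abbrev Idx {k : ℕ} (d : Fin k → ℕ) : Type := ∀ j, Fin (d j)

/-- The product operator `A 0 ⊗ ⋯ ⊗ A (k-1)`, in the product bases. -/
def tensorOp {k : ℕ} {d e : Fin k → ℕ} (A : ∀ j, Matrix (Fin (e j)) (Fin (d j)) ℂ) :
    Matrix (Idx e) (Idx d) ℂ :=
  fun x y => ∏ j, A j (x j) (y j)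

/-- An unnormalised pure `k`-partite state: a vector of `ℂ^{d 0} ⊗ ⋯ ⊗ ℂ^{d (k-1)}`, given by its
coefficients in the product basis. (The local Hilbert spaces are finite dimensional, and come with
an orthonormal basis.) -/
structure PureState (k : ℕ) where
  dim : Fin k → ℕ
  amp : Idx dim → ℂ

/-- Local unitary equivalence of two vectors, through local partial isometries. -/
def LUVec {k : ℕ} {d e : Fin k → ℕ} (v : Idx d → ℂ) (w : Idx e → ℂ) : Prop :=
  ∃ U : ∀ j, Matrix (Fin (e j)) (Fin (d j)) ℂ,
    (∀ j, U j * (U j)ᴴ * U j = U j) ∧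
    w = tensorOp U *ᵥ v ∧ v = tensorOp (fun j => (U j)ᴴ) *ᵥ w

/-- Local unitary equivalence of pure states. -/
def LUEquiv {k : ℕ} (φ ψ : PureState k) : Prop := LUVec φ.amp ψ.amp

/-- The matrix of the linear map sending the basis vector `|a⟩` to `|f a⟩`. -/
def basisMap {a b : ℕ} (f : Fin a → Fin b) : Matrix (Fin b) (Fin a) ℂ :=
  fun y x => if y = f x then 1 else 0

/-- The inclusion of `ℂ^a` into `ℂ^(a + b) = ℂ^a ⊕ ℂ^b`. -/
def inclL (a b : ℕ) : Matrix (Fin (a + b)) (Fin a) ℂ := basisMap (Fin.castAdd b)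

/-- The inclusion of `ℂ^b` into `ℂ^(a + b) = ℂ^a ⊕ ℂ^b`. -/
def inclR (a b : ℕ) : Matrix (Fin (a + b)) (Fin b) ℂ := basisMap (Fin.natAdd a)

/-- The direct sum `v ⊕ w` in `(H 0 ⊕ H' 0) ⊗ ⋯ ⊗ (H (k-1) ⊕ H' (k-1))`: the sum of the images of
`v` and `w` under the tensor products of the inclusions `H j → H j ⊕ H' j` and
`H' j → H j ⊕ H' j`. -/
def dirSumVec {k : ℕ} {d e : Fin k → ℕ} (v : Idx d → ℂ) (w : Idx e → ℂ) :
    Idx (fun j => d j + e j) → ℂ :=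
  tensorOp (fun j => inclL (d j) (e j)) *ᵥ v
    + tensorOp (fun j => inclR (d j) (e j)) *ᵥ w

/-- The tensor product `v ⊗ w` in `(H 0 ⊗ H' 0) ⊗ ⋯ ⊗ (H (k-1) ⊗ H' (k-1))`; the product basis of
`H j ⊗ H' j` is enumerated by `finProdFinEquiv`. -/
def tensorVec {k : ℕ} {d e : Fin k → ℕ} (v : Idx d → ℂ) (w : Idx e → ℂ) :
    Idx (fun j => d j * e j) → ℂ :=
  fun x => v (fun j => (finProdFinEquiv.symm (x j)).1)
    * w (fun j => (finProdFinEquiv.symm (x j)).2)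

/-- The direct sum of two pure states. -/
def PureState.dirSum {k : ℕ} (ψ φ : PureState k) : PureState k where
  dim := fun j => ψ.dim j + φ.dim j
  amp := dirSumVec ψ.amp φ.amp

/-- The tensor product of two pure states. -/
def PureState.tensor {k : ℕ} (ψ φ : PureState k) : PureState k where
  dim := fun j => ψ.dim j * φ.dim j
  amp := tensorVec ψ.amp φ.amp

/-- The unnormalised GHZ state `∑_{i < d} |i … i⟩` in `(ℂ^d)^{⊗ k}`. -/
def ghz (k d : ℕ) : PureState k where
  dim := fun _ => d
  amp := fun x => ∑ i : Fin d, if x = fun _ => i then 1 else 0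

/-- The product state `|0 … 0⟩` in `ℂ^{⊗ k}`. -/
def unitState (k : ℕ) : PureState k where
  dim := fun _ => 1
  amp := fun _ => 1

/-- The zero vector of `ℂ^{⊗ k}`. -/
def zeroState (k : ℕ) : PureState k where
  dim := fun _ => 1
  amp := fun _ => 0

/-- The tensor power `ψ^{⊗ n}`. -/
def PureState.tensorPow {k : ℕ} (ψ : PureState k) : ℕ → PureState k
  | 0 => unitState k
  | n + 1 => (ψ.tensorPow n).tensor ψ

/-! ### Local unitary classes form a commutative semiring -/

section tensorOp

variable {k : ℕ} {c d e : Fin k → ℕ}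

theorem tensorOp_mul (A : ∀ j, Matrix (Fin (e j)) (Fin (d j)) ℂ)
    (B : ∀ j, Matrix (Fin (d j)) (Fin (c j)) ℂ) :
    tensorOp A * tensorOp B = tensorOp (fun j => A j * B j) := by
  ext x y
  simp only [tensorOp, Matrix.mul_apply, ← Finset.prod_mul_distrib]
  rw [Finset.prod_univ_sum, Fintype.piFinset_univ]

theorem tensorOp_one : tensorOp (fun j => (1 : Matrix (Fin (d j)) (Fin (d j)) ℂ)) = 1 := by
  ext x y
  simp only [tensorOp, Matrix.one_apply]
  rw [Finset.prod_ite_zero]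
  simp [funext_iff]

theorem tensorOp_single (i : Fin k) (B : Matrix (Fin (d i)) (Fin (d i)) ℂ) (v : Idx d → ℂ)
    (x : Idx d) :
    (tensorOp (Function.update (fun j => (1 : Matrix (Fin (d j)) (Fin (d j)) ℂ)) i B) *ᵥ v) x
      = ∑ a, B (x i) a * v (Function.update x i a) := by
  classical
  simp only [Matrix.mulVec, dotProduct]
  symm
  apply Fintype.sum_of_injective (fun a => Function.update x i a)
  · intro a b h
    simpa using congrFun h i
  · intro y hy
    have : ∃ j, j ≠ i ∧ x j ≠ y j := by
      by_contra! hcon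
      apply hy
      refine ⟨y i, ?_⟩
      ext j
      by_cases hj : j = i
      · subst hj; simp
      · simp [Function.update_of_ne hj, hcon j hj]
    obtain ⟨j, hj, hxy⟩ := this
    have : tensorOp (Function.update (fun j => (1 : Matrix (Fin (d j)) (Fin (d j)) ℂ)) i B) x y
        = 0 := by
      apply Finset.prod_eq_zero (Finset.mem_univ j)
      simp [Function.update_of_ne hj, hxy]
    simp [this]
  · intro a
    congr 1
    simp only [tensorOp]
    rw [Finset.prod_eq_single i]
    · simp
    · intro j _ hj
      simp [Function.update_of_ne hj]
    · simp

end tensorOp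

/-- The orthogonal projection onto the common fixed vectors of two matrices. -/
theorem exists_common_projection {n : ℕ} (Q R : Matrix (Fin n) (Fin n) ℂ) :
    ∃ P : Matrix (Fin n) (Fin n) ℂ, Pᴴ = P ∧ P * P = P ∧ Q * P = P ∧ R * P = P ∧
      ∀ v, Q *ᵥ v = v → R *ᵥ v = v → P *ᵥ v = v := by
  let T := Matrix.toEuclideanCLM (n := Fin n) (𝕜 := ℂ)
  let S : Submodule ℂ (EuclideanSpace ℂ (Fin n)) :=
    LinearMap.ker (T Q - 1).toLinearMap
      ⊓ LinearMap.ker (T R - 1).toLinearMap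
  have hS : ∀ v, v ∈ S ↔ T Q v = v ∧ T R v = v := by
    intro v
    simp [S, sub_eq_zero]
  have hT : T (T.symm S.starProjection) = S.starProjection := T.apply_symm_apply _
  have key : ∀ A : Matrix (Fin n) (Fin n) ℂ, (∀ v ∈ S, T A v = v) →
      A * T.symm S.starProjection = T.symm S.starProjection := by
    intro A hA
    apply T.injective
    refine (map_mul T _ _).trans ?_
    change T A * T (T.symm _) = T (T.symm _)
    rw [hT]
    ext1 v
    exact hA _ (Submodule.starProjection_apply_mem _ _)
  refine ⟨T.symm S.starProjection, ?_, ?_, key Q fun v hv => ((hS v).1 hv).1,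
    key R fun v hv => ((hS v).1 hv).2, ?_⟩
  · apply T.injective
    rw [← Matrix.star_eq_conjTranspose]
    refine (map_star T _).trans ?_
    change star (T (T.symm _)) = T (T.symm _)
    rw [hT]
    exact isSelfAdjoint_starProjection S
  · apply key
    intro v hv
    rw [hT]
    exact Submodule.starProjection_eq_self_iff.2 hv
  · intro v hQ hR
    have hv : WithLp.toLp 2 v ∈ S := by
      rw [hS]
      constructor
      · change Matrix.toEuclideanCLM (n := Fin n) (𝕜 := ℂ) Q _ = _
        rw [Matrix.toEuclideanCLM_toLp, hQ]
      · change Matrix.toEuclideanCLM (n := Fin n) (𝕜 := ℂ) R _ = _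
        rw [Matrix.toEuclideanCLM_toLp, hR]
    have h1 : T (T.symm S.starProjection) (WithLp.toLp 2 v) = WithLp.toLp 2 v := by
      rw [hT]
      exact Submodule.starProjection_eq_self_iff.2 hv
    have h2 := Matrix.toEuclideanCLM_toLp (𝕜 := ℂ) (T.symm S.starProjection) v
    have h3 := h2.symm.trans h1
    simpa using congrArg WithLp.ofLp h3

namespace LUVec

variable {k : ℕ} {c d e f : Fin k → ℕ}

theorem refl (v : Idx d → ℂ) : LUVec v v :=
  ⟨fun _ => 1, by simp, by simp [tensorOp_one], by simp [tensorOp_one]⟩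

theorem symm {v : Idx d → ℂ} {w : Idx e → ℂ} (h : LUVec v w) : LUVec w v := by
  obtain ⟨U, h1, h2, h3⟩ := h
  refine ⟨fun j => (U j)ᴴ, fun j => ?_, h3, by simpa using h2⟩
  have := congrArg Matrix.conjTranspose (h1 j)
  simpa [Matrix.mul_assoc] using this

theorem tensorOp_fix {v : Idx d → ℂ}
    {Q R P : ∀ j, Matrix (Fin (d j)) (Fin (d j)) ℂ}
    (hQ : ∀ j, Q j * Q j = Q j) (hR : ∀ j, R j * R j = R j)
    (hQv : tensorOp Q *ᵥ v = v) (hRv : tensorOp R *ᵥ v = v)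
    (hP : ∀ j w, Q j *ᵥ w = w → R j *ᵥ w = w → P j *ᵥ w = w) :
    tensorOp P *ᵥ v = v := by
  classical
  have fib : ∀ (A : ∀ j, Matrix (Fin (d j)) (Fin (d j)) ℂ), (∀ j, A j * A j = A j) →
      tensorOp A *ᵥ v = v → ∀ (i : Fin k) (x : Idx d),
      A i *ᵥ (fun a => v (Function.update x i a)) = fun a => v (Function.update x i a) := by
    intro A hA hv i x
    have h1 : tensorOp (Function.update (fun j => (1 : Matrix (Fin (d j)) (Fin (d j)) ℂ)) i (A i))
        *ᵥ v = v := by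
      conv_lhs => rw [← hv]
      rw [Matrix.mulVec_mulVec, tensorOp_mul]
      conv_rhs => rw [← hv]
      congr 2
      ext1 j
      by_cases hj : j = i
      · subst hj; simp [hA]
      · simp [Function.update_of_ne hj]
    ext a
    have h2 := congrFun h1 (Function.update x i a)
    rw [tensorOp_single] at h2
    simpa [Matrix.mulVec, dotProduct] using h2
  have one : ∀ i, tensorOp (Function.update
      (fun j => (1 : Matrix (Fin (d j)) (Fin (d j)) ℂ)) i (P i)) *ᵥ v = v := by
    intro i
    ext x
    rw [tensorOp_single]
    have := congrFun (hP i _ (fib Q hQ hQv i x) (fib R hR hRv i x)) (x i)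
    simpa [Matrix.mulVec, dotProduct] using this
  have ind : ∀ s : Finset (Fin k), tensorOp (fun j => if j ∈ s then P j else 1) *ᵥ v = v := by
    intro s
    induction s using Finset.induction_on with
    | empty => simp [tensorOp_one]
    | insert i s hi ih =>
      conv_rhs => rw [← one i, ← ih]
      rw [Matrix.mulVec_mulVec, tensorOp_mul]
      congr 2
      ext1 j
      by_cases hj : j = i
      · subst hj; simp [hi]
      · simp [hj]
  simpa using ind Finset.univ

theorem trans {u : Idx c → ℂ} {v : Idx d → ℂ} {w : Idx e → ℂ} (h : LUVec u v) (h' : LUVec v w) :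
    LUVec u w := by
  obtain ⟨U, h1, h2, h3⟩ := h
  obtain ⟨V, g1, g2, g3⟩ := h'
  choose P p1 p2 p3 p4 p5 using fun j =>
    exists_common_projection (U j * (U j)ᴴ) ((V j)ᴴ * V j)
  have hP : tensorOp P *ᵥ v = v := by
    refine tensorOp_fix (Q := fun j => U j * (U j)ᴴ) (R := fun j => (V j)ᴴ * V j)
      (fun j => ?_) (fun j => ?_) ?_ ?_ p5
    · rw [← Matrix.mul_assoc, h1]
    · have := g1 j
      rw [Matrix.mul_assoc, ← Matrix.mul_assoc (V j), this]
    · rw [← tensorOp_mul, ← Matrix.mulVec_mulVec, ← h3, ← h2]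
    · rw [← tensorOp_mul, ← Matrix.mulVec_mulVec, ← g2, ← g3]
  refine ⟨fun j => V j * (P j * U j), fun j => ?_, ?_, ?_⟩
  · have a1 : ∀ M : Matrix (Fin (d j)) (Fin (c j)) ℂ,
        U j * ((U j)ᴴ * (P j * M)) = P j * M := by
      intro M
      have := p3 j
      simp only [← Matrix.mul_assoc] at this ⊢
      rw [this]
    have a2 : ∀ M : Matrix (Fin (d j)) (Fin (c j)) ℂ,
        (V j)ᴴ * (V j * (P j * M)) = P j * M := by
      intro M
      have := p4 j
      simp only [← Matrix.mul_assoc] at this ⊢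
      rw [this]
    have a3 : ∀ M : Matrix (Fin (d j)) (Fin (c j)) ℂ,
        P j * (P j * M) = P j * M := by
      intro M
      rw [← Matrix.mul_assoc, p2]
    simp only [Matrix.conjTranspose_mul, p1, Matrix.mul_assoc, a2, a3, a1]
  · rw [← tensorOp_mul, ← tensorOp_mul, ← Matrix.mulVec_mulVec, ← Matrix.mulVec_mulVec, ← h2, hP,
      ← g2]
  · simp only [Matrix.conjTranspose_mul, p1]
    rw [← tensorOp_mul, ← tensorOp_mul, ← Matrix.mulVec_mulVec, ← Matrix.mulVec_mulVec, ← g3, hP,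
      ← h3]

theorem of_isometry {v : Idx d → ℂ} {w : Idx e → ℂ} (V : ∀ j, Matrix (Fin (e j)) (Fin (d j)) ℂ)
    (hV : ∀ j, (V j)ᴴ * V j = 1) (h : w = tensorOp V *ᵥ v) : LUVec v w := by
  refine ⟨V, fun j => ?_, h, ?_⟩
  · rw [Matrix.mul_assoc, hV, Matrix.mul_one]
  · rw [h, Matrix.mulVec_mulVec, tensorOp_mul]
    simp [hV, tensorOp_one]

end LUVec

/-- Local unitary equivalence as an equivalence relation. -/
instance luSetoid (k : ℕ) : Setoid (PureState k) :=
  ⟨LUEquiv, fun φ => LUVec.refl φ.amp, LUVec.symm, LUVec.trans⟩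

/-- The set `S_k` of local unitary classes of unnormalised `k`-partite pure states. -/
def LUClass (k : ℕ) : Type := Quotient (luSetoid k)

/-- The class of a pure state. -/
def cls {k : ℕ} (ψ : PureState k) : LUClass k := Quotient.mk (luSetoid k) ψ

section basisMap

theorem basisMap_comp {a b c : ℕ} (g : Fin b → Fin c) (f : Fin a → Fin b) :
    basisMap g * basisMap f = basisMap (g ∘ f) := by
  ext x y
  simp [basisMap, Matrix.mul_apply]

theorem basisMap_isometry {a b : ℕ} {f : Fin a → Fin b} (hf : Function.Injective f) :
    (basisMap f)ᴴ * basisMap f = 1 := by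
  ext x y
  simp [basisMap, Matrix.mul_apply, Matrix.one_apply, hf.eq_iff, apply_ite, eq_comm]

theorem basisMap_orth {a b c : ℕ} {f : Fin a → Fin c} {g : Fin b → Fin c}
    (h : ∀ x y, f x ≠ g y) : (basisMap f)ᴴ * basisMap g = 0 := by
  ext x y
  simp [basisMap, Matrix.mul_apply, apply_ite, (h x y).symm]

theorem inclL_isometry (a b : ℕ) : (inclL a b)ᴴ * inclL a b = 1 :=
  basisMap_isometry (Fin.castAdd_injective _ _)

theorem inclR_isometry (a b : ℕ) : (inclR a b)ᴴ * inclR a b = 1 :=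
  basisMap_isometry (Fin.natAdd_injective _ _)

theorem castAdd_ne_natAdd {a b : ℕ} (x : Fin a) (y : Fin b) :
    Fin.castAdd b x ≠ Fin.natAdd a y := by
  simp [Fin.ext_iff]; omega

theorem inclL_orth (a b : ℕ) : (inclL a b)ᴴ * inclR a b = 0 :=
  basisMap_orth castAdd_ne_natAdd

theorem inclR_orth (a b : ℕ) : (inclR a b)ᴴ * inclL a b = 0 :=
  basisMap_orth fun x y => (castAdd_ne_natAdd y x).symm

theorem incl_total (a b : ℕ) :
    inclL a b * (inclL a b)ᴴ + inclR a b * (inclR a b)ᴴ = 1 := by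
  ext x y
  simp only [inclL, inclR, basisMap, Matrix.add_apply, Matrix.mul_apply,
    Matrix.conjTranspose_apply, Matrix.one_apply]
  induction x using Fin.addCases <;> induction y using Fin.addCases <;>
    simp [apply_ite, castAdd_ne_natAdd, (castAdd_ne_natAdd _ _).symm, eq_comm]

theorem tensorOp_basisMap {k : ℕ} {d e : Fin k → ℕ} (f : ∀ j, Fin (d j) ≃ Fin (e j))
    (v : Idx d → ℂ) (x : Idx d) :
    (tensorOp (fun j => basisMap (f j)) *ᵥ v) (fun j => f j (x j)) = v x := by
  simp only [Matrix.mulVec, dotProduct, tensorOp, basisMap]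
  simp only [Finset.prod_ite_zero]
  simp [← funext_iff]

end basisMap

section localKron

/-- The tensor product of two local operators. -/
def localKron {a b c d : ℕ} (A : Matrix (Fin b) (Fin a) ℂ) (B : Matrix (Fin d) (Fin c) ℂ) :
    Matrix (Fin (b * d)) (Fin (a * c)) ℂ :=
  fun x y => A (finProdFinEquiv.symm x).1 (finProdFinEquiv.symm y).1
    * B (finProdFinEquiv.symm x).2 (finProdFinEquiv.symm y).2

theorem localKron_mul {a b c d e f : ℕ} (A : Matrix (Fin b) (Fin a) ℂ)
    (B : Matrix (Fin d) (Fin c) ℂ) (A' : Matrix (Fin a) (Fin e) ℂ)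
    (B' : Matrix (Fin c) (Fin f) ℂ) :
    localKron A B * localKron A' B' = localKron (A * A') (B * B') := by
  ext x y
  simp only [localKron, Matrix.mul_apply]
  rw [← finProdFinEquiv.sum_comp, Fintype.sum_prod_type, Finset.sum_mul_sum]
  simp only [Equiv.symm_apply_apply]
  refine Finset.sum_congr rfl fun i _ => Finset.sum_congr rfl fun j _ => by ring

theorem localKron_conjTranspose {a b c d : ℕ} (A : Matrix (Fin b) (Fin a) ℂ)
    (B : Matrix (Fin d) (Fin c) ℂ) : (localKron A B)ᴴ = localKron Aᴴ Bᴴ := by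
  ext x y
  simp [localKron]

theorem localKron_one (a b : ℕ) :
    localKron (1 : Matrix (Fin a) (Fin a) ℂ) (1 : Matrix (Fin b) (Fin b) ℂ) = 1 := by
  ext x y
  obtain ⟨x, rfl⟩ := finProdFinEquiv.surjective x
  obtain ⟨y, rfl⟩ := finProdFinEquiv.surjective y
  simp only [localKron, Equiv.symm_apply_apply, Matrix.one_apply, EmbeddingLike.apply_eq_iff_eq,
    Prod.ext_iff]
  split_ifs <;> simp_all

theorem localKron_zero_left {a b c d : ℕ} (B : Matrix (Fin d) (Fin c) ℂ) :
    localKron (0 : Matrix (Fin b) (Fin a) ℂ) B = 0 := by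
  ext x y
  simp [localKron]

/-- Pairs of multi-indices are multi-indices of pairs. -/
def idxProd {k : ℕ} (d e : Fin k → ℕ) : Idx d × Idx e ≃ Idx (fun j => d j * e j) where
  toFun p j := finProdFinEquiv (p.1 j, p.2 j)
  invFun x := (fun j => (finProdFinEquiv.symm (x j)).1, fun j => (finProdFinEquiv.symm (x j)).2)
  left_inv p := by simp
  right_inv x := by
    ext j
    simp [- finProdFinEquiv_symm_apply]

theorem tensorOp_localKron {k : ℕ} {d e d' e' : Fin k → ℕ}
    (A : ∀ j, Matrix (Fin (d' j)) (Fin (d j)) ℂ) (B : ∀ j, Matrix (Fin (e' j)) (Fin (e j)) ℂ)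
    (v : Idx d → ℂ) (w : Idx e → ℂ) :
    tensorOp (fun j => localKron (A j) (B j)) *ᵥ tensorVec v w
      = tensorVec (tensorOp A *ᵥ v) (tensorOp B *ᵥ w) := by
  ext x
  simp only [tensorVec, Matrix.mulVec, dotProduct]
  rw [← (idxProd d e).sum_comp, Fintype.sum_prod_type, Finset.sum_mul_sum]
  refine Finset.sum_congr rfl fun i _ => Finset.sum_congr rfl fun j _ => ?_
  simp only [idxProd, Equiv.coe_fn_mk, Equiv.symm_apply_apply, tensorOp, localKron,
    Finset.prod_mul_distrib]
  ring

end localKron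

namespace LUVec

variable {k : ℕ} {c d e f : Fin k → ℕ}

theorem of_equiv {v : Idx d → ℂ} {w : Idx e → ℂ} (g : ∀ j, Fin (d j) ≃ Fin (e j))
    (h : ∀ x, w (fun j => g j (x j)) = v x) : LUVec v w := by
  refine of_isometry (fun j => basisMap (g j)) (fun j => basisMap_isometry (g j).injective) ?_
  ext y
  have := tensorOp_basisMap g v (fun j => (g j).symm (y j))
  have h' := h (fun j => (g j).symm (y j))
  simp only [Equiv.apply_symm_apply] at this h'
  rw [this, h']

theorem dirSum_of (v : Idx d → ℂ) (w : Idx e → ℂ) {u : Idx f → ℂ}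
    (A : ∀ j, Matrix (Fin (f j)) (Fin (d j)) ℂ) (B : ∀ j, Matrix (Fin (f j)) (Fin (e j)) ℂ)
    (hA : ∀ j, (A j)ᴴ * A j = 1) (hB : ∀ j, (B j)ᴴ * B j = 1) (hAB : ∀ j, (A j)ᴴ * B j = 0)
    (h : u = tensorOp A *ᵥ v + tensorOp B *ᵥ w) : LUVec (dirSumVec v w) u := by
  have hBA : ∀ j, (B j)ᴴ * A j = 0 := by
    intro j
    have := congrArg Matrix.conjTranspose (hAB j)
    simpa using this
  have r {m a b : ℕ} {X : Matrix (Fin m) (Fin a) ℂ} {Y : Matrix (Fin m) (Fin b) ℂ}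
      {Z : Matrix (Fin a) (Fin b) ℂ} (h : Xᴴ * Y = Z) {c : ℕ} (M : Matrix (Fin b) (Fin c) ℂ) :
      Xᴴ * (Y * M) = Z * M := by
    rw [← Matrix.mul_assoc, h]
  refine of_isometry (fun j => A j * (inclL (d j) (e j))ᴴ
    + B j * (inclR (d j) (e j))ᴴ) (fun j => ?_) ?_
  · simp only [Matrix.conjTranspose_add, Matrix.conjTranspose_mul,
      Matrix.conjTranspose_conjTranspose, Matrix.add_mul, Matrix.mul_add, Matrix.mul_assoc,
      r (hA j), r (hB j), r (hAB j), r (hBA j), Matrix.zero_mul, Matrix.mul_zero, Matrix.one_mul,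
      add_zero, zero_add]
    exact incl_total (d j) (e j)
  · simp only [dirSumVec, Matrix.mulVec_add, Matrix.mulVec_mulVec, tensorOp_mul,
      Matrix.add_mul, Matrix.mul_assoc, inclL_isometry, inclR_isometry, inclL_orth, inclR_orth, Matrix.mul_zero, Matrix.mul_one, add_zero, zero_add, h]

theorem dirSum_congr_aux {d' e' : Fin k → ℕ} {v : Idx d → ℂ} {v' : Idx d' → ℂ} {w : Idx e → ℂ}
    {w' : Idx e' → ℂ} (U : ∀ j, Matrix (Fin (d' j)) (Fin (d j)) ℂ)
    (V : ∀ j, Matrix (Fin (e' j)) (Fin (e j)) ℂ) (hU : v' = tensorOp U *ᵥ v)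
    (hV : w' = tensorOp V *ᵥ w) :
    dirSumVec v' w' = tensorOp (fun j =>
      inclL (d' j) (e' j) * (U j * (inclL (d j) (e j))ᴴ)
      + inclR (d' j) (e' j) * (V j * (inclR (d j) (e j))ᴴ)) *ᵥ dirSumVec v w := by
  simp only [dirSumVec, hU, hV, Matrix.mulVec_add, Matrix.mulVec_mulVec, tensorOp_mul,
    Matrix.add_mul, Matrix.mul_assoc, inclL_isometry, inclR_isometry, inclL_orth, inclR_orth, Matrix.mul_zero, Matrix.mul_one, add_zero, zero_add]

theorem dirSum_congr {d' e' : Fin k → ℕ} {v : Idx d → ℂ} {v' : Idx d' → ℂ} {w : Idx e → ℂ}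
    {w' : Idx e' → ℂ} (h : LUVec v v') (h' : LUVec w w') :
    LUVec (dirSumVec v w) (dirSumVec v' w') := by
  obtain ⟨U, h1, h2, h3⟩ := h
  obtain ⟨V, g1, g2, g3⟩ := h'
  have r {m a b : ℕ} {X : Matrix (Fin m) (Fin a) ℂ} {Y : Matrix (Fin m) (Fin b) ℂ}
      {Z : Matrix (Fin a) (Fin b) ℂ} (h : Xᴴ * Y = Z) {c : ℕ} (M : Matrix (Fin b) (Fin c) ℂ) :
      Xᴴ * (Y * M) = Z * M := by
    rw [← Matrix.mul_assoc, h]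
  refine ⟨_, fun j => ?_, dirSum_congr_aux U V h2 g2, ?_⟩
  · have u1 := h1 j
    have v1 := g1 j
    simp only [Matrix.mul_assoc] at u1 v1
    have u2 {c : ℕ} (M : Matrix (Fin (d j)) (Fin c) ℂ) :
        U j * ((U j)ᴴ * (U j * M)) = U j * M := by
      rw [← Matrix.mul_assoc (U j)ᴴ, ← Matrix.mul_assoc, u1]
    have v2 {c : ℕ} (M : Matrix (Fin (e j)) (Fin c) ℂ) :
        V j * ((V j)ᴴ * (V j * M)) = V j * M := by
      rw [← Matrix.mul_assoc (V j)ᴴ, ← Matrix.mul_assoc, v1]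
    simp only [Matrix.conjTranspose_add, Matrix.conjTranspose_mul,
      Matrix.conjTranspose_conjTranspose, Matrix.add_mul, Matrix.mul_add, Matrix.mul_assoc,
      r (inclL_isometry _ _), r (inclR_isometry _ _), r (inclL_orth _ _), r (inclR_orth _ _), Matrix.mul_zero, Matrix.zero_mul, Matrix.one_mul,
      add_zero, zero_add, u2, v2]
  · have := dirSum_congr_aux (fun j => (U j)ᴴ) (fun j => (V j)ᴴ) h3 g3
    simpa only [Matrix.conjTranspose_add, Matrix.conjTranspose_mul,
      Matrix.conjTranspose_conjTranspose, Matrix.mul_assoc] using this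

theorem tensor_congr {d' e' : Fin k → ℕ} {v : Idx d → ℂ} {v' : Idx d' → ℂ} {w : Idx e → ℂ}
    {w' : Idx e' → ℂ} (h : LUVec v v') (h' : LUVec w w') :
    LUVec (tensorVec v w) (tensorVec v' w') := by
  obtain ⟨U, h1, h2, h3⟩ := h
  obtain ⟨V, g1, g2, g3⟩ := h'
  refine ⟨fun j => localKron (U j) (V j), fun j => ?_, ?_, ?_⟩
  · simp only [localKron_conjTranspose, localKron_mul, h1, g1]
  · rw [tensorOp_localKron, ← h2, ← g2]
  · simp only [localKron_conjTranspose]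
    rw [tensorOp_localKron, ← h3, ← g3]

theorem dirSum_comm (v : Idx d → ℂ) (w : Idx e → ℂ) : LUVec (dirSumVec v w) (dirSumVec w v) :=
  dirSum_of v w (fun j => inclR (e j) (d j)) (fun j => inclL (e j) (d j))
    (fun _ => inclR_isometry _ _) (fun _ => inclL_isometry _ _)
    (fun _ => inclR_orth _ _) (add_comm _ _)

theorem dirSum_assoc (u : Idx c → ℂ) (v : Idx d → ℂ) (w : Idx e → ℂ) :
    LUVec (dirSumVec (dirSumVec u v) w) (dirSumVec u (dirSumVec v w)) := by
  refine of_isometry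
    (fun j => basisMap (Fin.cast (Nat.add_assoc (c j) (d j) (e j))))
    (fun j => basisMap_isometry (Fin.cast_injective _)) ?_
  have h1 : ∀ j, Fin.cast (Nat.add_assoc (c j) (d j) (e j)) ∘ Fin.castAdd (e j)
      ∘ Fin.castAdd (d j) = Fin.castAdd (d j + e j) := by
    intro j; ext x; simp
  have h2 : ∀ j, Fin.cast (Nat.add_assoc (c j) (d j) (e j)) ∘ Fin.castAdd (e j)
      ∘ Fin.natAdd (c j) = Fin.natAdd (c j) ∘ Fin.castAdd (e j) := by
    intro j; ext x; simp
  have h3 : ∀ j, Fin.cast (Nat.add_assoc (c j) (d j) (e j)) ∘ Fin.natAdd (c j + d j)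
      = Fin.natAdd (c j) ∘ Fin.natAdd (d j) := by
    intro j; ext x; simp [Nat.add_assoc]
  simp only [dirSumVec, inclL, inclR, Matrix.mulVec_add, Matrix.mulVec_mulVec, tensorOp_mul,
    basisMap_comp, h1, h2, h3, add_assoc]

theorem zero_dirSum (v : Idx d → ℂ) : LUVec (dirSumVec (0 : Idx e → ℂ) v) v := by
  refine LUVec.symm (of_isometry (fun j => inclR (e j) (d j))
    (fun j => inclR_isometry _ _) ?_)
  simp only [dirSumVec, Matrix.mulVec_zero, zero_add]

theorem tensor_comm (v : Idx d → ℂ) (w : Idx e → ℂ) : LUVec (tensorVec v w) (tensorVec w v) := by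
  refine of_equiv (fun j => (finProdFinEquiv.symm.trans (Equiv.prodComm _ _)).trans
    finProdFinEquiv) fun x => ?_
  simp only [tensorVec, Equiv.trans_apply, Equiv.symm_apply_apply, Equiv.prodComm_apply,
    Prod.fst_swap, Prod.snd_swap]
  rw [mul_comm]

theorem tensor_assoc (u : Idx c → ℂ) (v : Idx d → ℂ) (w : Idx e → ℂ) :
    LUVec (tensorVec (tensorVec u v) w) (tensorVec u (tensorVec v w)) := by
  refine of_equiv (fun j => ((finProdFinEquiv.symm.trans
    ((Equiv.prodCongr finProdFinEquiv.symm (Equiv.refl _)).trans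
    ((Equiv.prodAssoc _ _ _).trans (Equiv.prodCongr (Equiv.refl _) finProdFinEquiv)))).trans
    finProdFinEquiv)) fun x => ?_
  simp only [tensorVec, Equiv.trans_apply, Equiv.symm_apply_apply, Equiv.prodCongr_apply,
    Equiv.prodAssoc_apply, Prod.map_fst, Prod.map_snd, Equiv.refl_apply]
  rw [mul_assoc]

theorem unit_tensor (v : Idx d → ℂ) :
    LUVec (tensorVec (fun _ => 1 : Idx (fun _ : Fin k => 1) → ℂ) v) v := by
  refine of_equiv (fun j => finProdFinEquiv.symm.trans (Equiv.uniqueProd _ (Fin 1))) fun x => ?_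
  simp only [tensorVec, one_mul, Equiv.trans_apply, Equiv.uniqueProd_apply]

theorem zero_tensor (v : Idx d → ℂ) :
    LUVec (tensorVec (0 : Idx e → ℂ) v) (0 : Idx e → ℂ) := by
  have : tensorVec (0 : Idx e → ℂ) v = 0 := by
    ext x
    simp [tensorVec]
  rw [this]
  exact ⟨fun _ => 0, fun _ => by simp, by simp, by simp⟩

theorem dirSum_tensor (u : Idx c → ℂ) (v : Idx d → ℂ) (w : Idx e → ℂ) :
    LUVec (tensorVec (dirSumVec u v) w) (dirSumVec (tensorVec u w) (tensorVec v w)) := by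
  refine LUVec.symm (dirSum_of (tensorVec u w) (tensorVec v w)
    (fun j => localKron (inclL (c j) (d j)) 1)
    (fun j => localKron (inclR (c j) (d j)) 1)
    (fun j => ?_) (fun j => ?_) (fun j => ?_) ?_)
  · rw [localKron_conjTranspose, localKron_mul, inclL_isometry]
    simpa using localKron_one _ _
  · rw [localKron_conjTranspose, localKron_mul, inclR_isometry]
    simpa using localKron_one _ _
  · rw [localKron_conjTranspose, localKron_mul, inclL_orth]
    exact localKron_zero_left _
  · rw [tensorOp_localKron, tensorOp_localKron, tensorOp_one, Matrix.one_mulVec]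
    ext x
    simp only [dirSumVec, tensorVec, Pi.add_apply, add_mul]

end LUVec

/-- The commutative semiring `(S_k, ⊕, ⊗)`. -/
instance (k : ℕ) : CommSemiring (LUClass k) where
  zero := cls (zeroState k)
  one := cls (unitState k)
  add := Quotient.map₂ PureState.dirSum fun _ _ h _ _ h' => LUVec.dirSum_congr h h'
  mul := Quotient.map₂ PureState.tensor fun _ _ h _ _ h' => LUVec.tensor_congr h h'
  nsmul := letI : Zero (LUClass k) := ⟨cls (zeroState k)⟩
    letI : Add (LUClass k) := ⟨Quotient.map₂ PureState.dirSum fun _ _ h _ _ h' => LUVec.dirSum_congr h h'⟩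
    nsmulRec
  add_assoc := by
    rintro ⟨a⟩ ⟨b⟩ ⟨c⟩
    exact Quotient.sound (LUVec.dirSum_assoc a.amp b.amp c.amp)
  add_comm := by
    rintro ⟨a⟩ ⟨b⟩
    exact Quotient.sound (LUVec.dirSum_comm a.amp b.amp)
  zero_add := by
    rintro ⟨a⟩
    exact Quotient.sound (LUVec.zero_dirSum a.amp)
  add_zero := by
    rintro ⟨a⟩
    exact Quotient.sound ((LUVec.dirSum_comm _ _).trans (LUVec.zero_dirSum a.amp))
  mul_assoc := by
    rintro ⟨a⟩ ⟨b⟩ ⟨c⟩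
    exact Quotient.sound (LUVec.tensor_assoc a.amp b.amp c.amp)
  mul_comm := by
    rintro ⟨a⟩ ⟨b⟩
    exact Quotient.sound (LUVec.tensor_comm a.amp b.amp)
  one_mul := by
    rintro ⟨a⟩
    exact Quotient.sound (LUVec.unit_tensor a.amp)
  mul_one := by
    rintro ⟨a⟩
    exact Quotient.sound ((LUVec.tensor_comm _ _).trans (LUVec.unit_tensor a.amp))
  zero_mul := by
    rintro ⟨a⟩
    exact Quotient.sound (LUVec.zero_tensor a.amp)
  mul_zero := by
    rintro ⟨a⟩
    exact Quotient.sound ((LUVec.tensor_comm _ _).trans (LUVec.zero_tensor a.amp))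
  right_distrib := by
    rintro ⟨a⟩ ⟨b⟩ ⟨c⟩
    exact Quotient.sound (LUVec.dirSum_tensor a.amp b.amp c.amp)
  left_distrib := by
    rintro ⟨c⟩ ⟨a⟩ ⟨b⟩
    exact Quotient.sound ((LUVec.tensor_comm _ _).trans ((LUVec.dirSum_tensor a.amp b.amp c.amp).trans
      (LUVec.dirSum_congr (LUVec.tensor_comm _ _) (LUVec.tensor_comm _ _))))

/-! ### LOCC channels -/

/-- A `k`-partite state space `B(H 0) ⊗ ⋯ ⊗ B(H (k-1)) ⊗ Diag(ℂ^Reg)`: local dimensions together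
with a finite classical register. -/
structure StateSpace (k : ℕ) where
  dim : Fin k → ℕ
  Reg : Type
  [fin : Fintype Reg]
  [dec : DecidableEq Reg]

attribute [instance] StateSpace.fin StateSpace.dec

/-- Operators on `H 0 ⊗ ⋯ ⊗ H (k-1) ⊗ ℂ^Reg`. The states of the state space are the positive ones
which are diagonal in the register; channels are given by a formula on all operators, and map states
to states. -/
abbrev StateSpace.Op {k : ℕ} (A : StateSpace k) : Type :=
  Matrix (Idx A.dim × A.Reg) (Idx A.dim × A.Reg) ℂ

/-- The operator `(K)_i = I ⊗ ⋯ ⊗ K ⊗ ⋯ ⊗ I`, with `K` acting on the `i`-th factor, between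
spaces `d` and `e` whose other factors agree (so that the other indices can be compared as
numbers). -/
def actAt {k : ℕ} {d e : Fin k → ℕ} (i : Fin k) (K : Matrix (Fin (e i)) (Fin (d i)) ℂ) :
    Matrix (Idx e) (Idx d) ℂ :=
  fun x y => if ∀ l, l ≠ i → (x l : ℕ) = (y l : ℕ) then K (x i) (y i) else 0

/-- The data of a one-step LOCC channel from `A` to `B`: a party `i`, the other parties' spaces
being unchanged; a finite index set `J` with maps `f : J → 𝒳`, `g : J → 𝒴` into the registers; and
Kraus operators `K j : H i → H' i` with `∑ j, K j* K j ⊗ |f j⟩⟨f j| ≤ I`. -/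
structure OneStep {k : ℕ} (A B : StateSpace k) where
  party : Fin k
  same : ∀ l, l ≠ party → B.dim l = A.dim l
  J : Type
  [fin : Fintype J]
  f : J → A.Reg
  g : J → B.Reg
  kraus : J → Matrix (Fin (B.dim party)) (Fin (A.dim party)) ℂ
  kraus_le : (1 - ∑ j, ((kraus j)ᴴ * kraus j) ⊗ₖ Matrix.single (f j) (f j) (1 : ℂ)).PosSemidef

attribute [instance] OneStep.fin

/-- The operator `(K j)_i ⊗ |g j⟩⟨f j|`. -/
def OneStep.op {k : ℕ} {A B : StateSpace k} (Λ : OneStep A B) (j : Λ.J) :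
    Matrix (Idx B.dim × B.Reg) (Idx A.dim × A.Reg) ℂ :=
  actAt Λ.party (Λ.kraus j) ⊗ₖ Matrix.single (Λ.g j) (Λ.f j) (1 : ℂ)

/-- The one-step LOCC channel
`ρ ↦ ∑ j, ((K j)_i ⊗ |g j⟩⟨f j|) ρ ((K j*)_i ⊗ |f j⟩⟨g j|)`. -/
def OneStep.apply {k : ℕ} {A B : StateSpace k} (Λ : OneStep A B) (ρ : A.Op) : B.Op :=
  ∑ j, Λ.op j * ρ * (Λ.op j)ᴴ

/-- LOCC channels: compositions of finite sequences of composable one-step LOCC channels. -/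
inductive IsLOCC {k : ℕ} : ∀ {A B : StateSpace k}, (A.Op → B.Op) → Prop
  | refl (A : StateSpace k) : IsLOCC (fun ρ : A.Op => ρ)
  | step {A B C : StateSpace k} (Φ : A.Op → B.Op) (Λ : OneStep B C) :
      IsLOCC Φ → IsLOCC (fun ρ => Λ.apply (Φ ρ))

/-- The state space, with one-point register, in which a pure state lives. -/
def PureState.space {k : ℕ} (ψ : PureState k) : StateSpace k := ⟨ψ.dim, Unit⟩

/-- The state `|ψ⟩⟨ψ|`. -/
def PureState.density {k : ℕ} (ψ : PureState k) : ψ.space.Op :=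
  fun x y => ψ.amp x.1 * star (ψ.amp y.1)

/-- LOCC convertibility `ψ → φ`: some LOCC channel maps `|ψ⟩⟨ψ|` to `|φ⟩⟨φ|`. -/
def Converts {k : ℕ} (ψ φ : PureState k) : Prop :=
  ∃ Φ : ψ.space.Op → φ.space.Op, IsLOCC Φ ∧ Φ ψ.density = φ.density

/-! ### LOCC convertibility is well defined on local unitary classes -/

theorem IsLOCC.comp {k : ℕ} {A B C : StateSpace k} {Φ : A.Op → B.Op} {Ψ : B.Op → C.Op}
    (hΨ : IsLOCC Ψ) (hΦ : IsLOCC Φ) : IsLOCC (fun ρ => Ψ (Φ ρ)) := by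
  induction hΨ with
  | refl => exact hΦ
  | step Ψ Λ _ ih => exact IsLOCC.step _ Λ ih

theorem Converts.refl {k : ℕ} (ψ : PureState k) : Converts ψ ψ := ⟨_, IsLOCC.refl _, rfl⟩

theorem Converts.trans {k : ℕ} {ψ φ χ : PureState k} (h : Converts ψ φ) (h' : Converts φ χ) :
    Converts ψ χ := by
  obtain ⟨Φ, h1, h2⟩ := h
  obtain ⟨Ψ, g1, g2⟩ := h'
  exact ⟨_, g1.comp h1, by rw [h2, g2]⟩

theorem Converts.single {k : ℕ} {d e : Fin k → ℕ} (v : Idx d → ℂ) (i : Fin k)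
    (same : ∀ l, l ≠ i → e l = d l) (K : Matrix (Fin (e i)) (Fin (d i)) ℂ)
    (hK : (1 - Kᴴ * K).PosSemidef) : Converts ⟨d, v⟩ ⟨e, actAt i K *ᵥ v⟩ := by
  let Λ : OneStep (PureState.space ⟨d, v⟩) (PureState.space ⟨e, actAt i K *ᵥ v⟩) :=
    { party := i
      same := same
      J := Unit
      f := fun _ => ()
      g := fun _ => ()
      kraus := fun _ => K
      kraus_le := by
        have := hK.submatrix (Prod.fst : Fin (d i) × Unit → Fin (d i))
        have h2 : (1 - Kᴴ * K).submatrix (Prod.fst : Fin (d i) × Unit → Fin (d i)) Prod.fst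
            = 1 - ∑ _j : Unit, (Kᴴ * K) ⊗ₖ Matrix.single () () (1 : ℂ) := by
          ext ⟨x, u⟩ ⟨y, u'⟩
          simp [Matrix.kroneckerMap_apply, Matrix.one_apply]
        rw [h2] at this
        exact this }
  refine ⟨_, IsLOCC.step _ Λ (IsLOCC.refl _), ?_⟩
  have hop : ∀ x y, Λ.op () x y = actAt i K x.1 y.1 := by
    rintro ⟨x, u⟩ ⟨y, u'⟩
    change actAt i K x y * Matrix.single () () (1 : ℂ) u u' = actAt i K x y
    have : Matrix.single () () (1 : ℂ) u u' = 1 := Matrix.single_apply_same _ _ _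
    rw [this, mul_one]
  ext x y
  change (∑ j : Unit, Λ.op j * PureState.density ⟨d, v⟩ * (Λ.op j)ᴴ) x y = _
  rw [Fintype.sum_unique]
  change ∑ q, (∑ p, Λ.op () x p * PureState.density ⟨d, v⟩ p q) * star (Λ.op () y q) = _
  simp only [hop]
  change ∑ q : Idx d × Unit, (∑ p : Idx d × Unit, actAt i K x.1 p.1 * (v p.1 * star (v q.1)))
    * star (actAt i K y.1 q.1)
    = (∑ p, actAt i K x.1 p * v p) * star (∑ q, actAt i K y.1 q * v q)
  rw [Fintype.sum_prod_type]
  simp only [Fintype.sum_prod_type, Finset.univ_unique, Finset.sum_singleton, star_sum,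
    Finset.sum_mul, Finset.mul_sum]
  refine Finset.sum_congr rfl fun a _ => Finset.sum_congr rfl fun b _ => ?_
  rw [star_mul]
  ring

theorem actAt_mul_tensorOp {k : ℕ} {c d e : Fin k → ℕ} (i : Fin k)
    (same : ∀ l, l ≠ i → e l = d l) (K : Matrix (Fin (e i)) (Fin (d i)) ℂ)
    (A : ∀ j, Matrix (Fin (d j)) (Fin (c j)) ℂ) (B : ∀ j, Matrix (Fin (e j)) (Fin (c j)) ℂ)
    (hi : K * A i = B i)
    (hl : ∀ l, l ≠ i → ∀ (x : Fin (d l)) (x' : Fin (e l)) y,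
      (x : ℕ) = (x' : ℕ) → A l x y = B l x' y) :
    actAt i K * tensorOp A = tensorOp B := by
  classical
  ext x y
  rw [Matrix.mul_apply]
  let z : Fin (d i) → Idx d := fun a l =>
    if h : l = i then Fin.cast (by rw [h]) a else Fin.cast (same l h) (x l)
  have hzi : ∀ a, z a i = a := fun a => by simp [z]
  have hzl : ∀ a l, l ≠ i → (z a l : ℕ) = x l := fun a l h => by simp [z, h]
  have h1 : ∑ a, actAt i K x (z a) * tensorOp A (z a) y = ∑ w, actAt i K x w * tensorOp A w y := by
    apply Fintype.sum_of_injective z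
    · intro a b h
      have := congrFun h i
      rwa [hzi, hzi] at this
    · intro w hw
      have : ¬ ∀ l, l ≠ i → (x l : ℕ) = (w l : ℕ) := by
        intro hcon
        apply hw
        refine ⟨w i, ?_⟩
        funext l
        by_cases h : l = i
        · subst h; exact hzi _
        · apply Fin.ext
          rw [hzl _ _ h, hcon l h]
      simp [actAt, this]
    · intro a
      rfl
  rw [← h1]
  have h2 : ∀ a, actAt i K x (z a) * tensorOp A (z a) y
      = (K (x i) a * A i a (y i)) * ∏ l ∈ Finset.univ.erase i, B l (x l) (y l) := by
    intro a
    have : ∀ l, l ≠ i → (x l : ℕ) = (z a l : ℕ) := fun l h => (hzl a l h).symm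
    simp only [actAt, if_pos this, tensorOp, hzi]
    rw [← Finset.mul_prod_erase _ _ (Finset.mem_univ i), hzi, mul_assoc]
    congr 2
    refine Finset.prod_congr rfl fun l hlm => ?_
    exact hl l (Finset.ne_of_mem_erase hlm) _ _ _ (hzl a l (Finset.ne_of_mem_erase hlm))
  simp only [h2]
  rw [← Finset.sum_mul, ← Matrix.mul_apply, hi]
  exact Finset.mul_prod_erase _ (fun l => B l (x l) (y l)) (Finset.mem_univ i)

theorem LUVec.converts_aux {k : ℕ} {d e : Fin k → ℕ} (v : Idx d → ℂ)
    (U : ∀ j, Matrix (Fin (e j)) (Fin (d j)) ℂ) (hU : ∀ j, U j * (U j)ᴴ * U j = U j) (m : ℕ) :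
    m ≤ k → ∀ (D : Fin k → ℕ) (T : ∀ j, Matrix (Fin (D j)) (Fin (d j)) ℂ),
      (∀ l : Fin k, l.1 < m → D l = e l ∧ ∀ (x : Fin (D l)) (x' : Fin (e l)) y,
        (x : ℕ) = (x' : ℕ) → T l x y = U l x' y) →
      (∀ l : Fin k, ¬ l.1 < m → D l = d l ∧ ∀ x y, T l x y = if (x : ℕ) = (y : ℕ) then 1 else 0) →
      Converts ⟨d, v⟩ ⟨D, tensorOp T *ᵥ v⟩ := by
  induction m with
  | zero =>
    intro _ D T _ h
    obtain rfl : D = d := funext fun l => (h l (by simp)).1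
    have : T = fun l => 1 := by
      funext l
      ext x y
      rw [(h l (by simp)).2, Matrix.one_apply]
      simp [Fin.ext_iff]
    rw [this, tensorOp_one, Matrix.one_mulVec]
    exact Converts.refl _
  | succ m ih =>
    intro hm D T h1 h2
    let i : Fin k := ⟨m, hm⟩
    let D' : Fin k → ℕ := fun l => if l = i then d l else D l
    have hD'i : D' i = d i := by simp [D']
    have hD' : ∀ l, l ≠ i → D' l = D l := fun l h => by simp [D', h]
    let T' : ∀ j, Matrix (Fin (D' j)) (Fin (d j)) ℂ := fun l x y =>
      if h : l = i then (if (x : ℕ) = (y : ℕ) then 1 else 0) else T l (Fin.cast (hD' l h) x) y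
    have step : Converts ⟨d, v⟩ ⟨D', tensorOp T' *ᵥ v⟩ := by
      apply ih (by omega)
      · intro l hl
        have hli : l ≠ i := by
          rintro rfl
          simp [i] at hl
        obtain ⟨a, b⟩ := h1 l (by omega)
        refine ⟨by rw [hD' l hli, a], fun x x' y hx => ?_⟩
        simp only [T', dif_neg hli]
        exact b _ _ _ (by simpa using hx)
      · intro l hl
        by_cases hli : l = i
        · refine ⟨by rw [hli, hD'i], fun x y => ?_⟩
          simp only [T', dif_pos hli]
        · have hl' : ¬ l.1 < m + 1 := by
            intro hcon
            apply hli
            apply Fin.ext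
            simp only [i]
            omega
          obtain ⟨a, b⟩ := h2 l hl'
          refine ⟨by rw [hD' l hli, a], fun x y => ?_⟩
          simp only [T', dif_neg hli]
          simpa using b (Fin.cast (hD' l hli) x) y
    obtain ⟨hDi, hTi⟩ := h1 i (by simp [i])
    let K : Matrix (Fin (D i)) (Fin (D' i)) ℂ := (U i).submatrix (Fin.cast hDi) (Fin.cast hD'i)
    have hK : (1 - Kᴴ * K).PosSemidef := by
      let W := (U i)ᴴ * U i
      have hW : W * W = W := by
        simp only [W]
        rw [Matrix.mul_assoc, ← Matrix.mul_assoc (U i), hU]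
      have hW' : Wᴴ = W := by simp [W]
      have e1 : 1 - W = (1 - W)ᴴ * (1 - W) := by
        rw [Matrix.conjTranspose_sub, Matrix.conjTranspose_one, hW', Matrix.sub_mul,
          Matrix.one_mul, Matrix.mul_sub, Matrix.mul_one, hW]
        simp
      have e2 : (1 - W).PosSemidef := by
        rw [e1]
        exact Matrix.posSemidef_conjTranspose_mul_self _
      have e3 := e2.submatrix (Fin.cast hD'i)
      convert e3 using 1
      ext x y
      simp only [Matrix.sub_apply, Matrix.submatrix_apply, K, W, Matrix.mul_apply,
        Matrix.conjTranspose_apply, Matrix.one_apply]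
      congr 1
      · simp [Fin.ext_iff]
      · exact Fintype.sum_equiv (finCongr hDi) _ _ fun a => rfl
    have same : ∀ l, l ≠ i → D l = D' l := fun l h => (hD' l h).symm
    have := step.trans (Converts.single (tensorOp T' *ᵥ v) i same K hK)
    rw [Matrix.mulVec_mulVec, actAt_mul_tensorOp i same K T' T] at this
    · exact this
    · ext x y
      rw [Matrix.mul_apply]
      rw [Finset.sum_eq_single (Fin.cast hD'i.symm y)]
      · simp only [T', dif_pos]
        simp [K, hTi x (Fin.cast hDi x) y rfl]
      · intro b _ hb
        have : ¬ (b : ℕ) = (y : ℕ) := by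
          intro hcon
          apply hb
          apply Fin.ext
          simpa using hcon
        simp [T', this]
      · simp
    · intro l hl x x' y hx
      simp only [T', dif_neg hl]
      congr 1
      apply Fin.ext
      simpa using hx

theorem LUEquiv.converts {k : ℕ} {ψ φ : PureState k} (h : LUEquiv ψ φ) : Converts ψ φ := by
  obtain ⟨d, v⟩ := ψ
  obtain ⟨e, w⟩ := φ
  obtain ⟨U, h1, h2, -⟩ := h
  simp only at U h1 h2
  subst h2
  refine LUVec.converts_aux v U h1 k le_rfl e U (fun l _ => ⟨rfl, fun x x' y hx => ?_⟩)
    (fun l hl => absurd l.2 hl)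
  rw [Fin.ext hx]

/-- The preorder on `S_k`: `[ψ] ≥ [φ]` iff `ψ → φ` under LOCC. -/
instance (k : ℕ) : Preorder (LUClass k) where
  le := Quotient.lift₂ (fun φ ψ => Converts ψ φ) (by
    intro φ ψ φ' ψ' h h'
    apply propext
    exact ⟨fun g => (LUEquiv.converts (LUVec.symm h')).trans (g.trans (LUEquiv.converts h)),
      fun g => (LUEquiv.converts h').trans (g.trans (LUEquiv.converts (LUVec.symm h)))⟩)
  le_refl := by
    rintro ⟨ψ⟩
    exact Converts.refl ψ
  le_trans := by
    rintro ⟨ψ⟩ ⟨φ⟩ ⟨χ⟩ h h'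
    exact Converts.trans h' h

/-- The asymptotic preorder: `a ≲ b` iff `a ^ N ≤ 2 ^ (x N) * b ^ N` for all `N`, for some
`x N ∈ o(N)`. -/
def AsympLE {k : ℕ} (a b : LUClass k) : Prop :=
  ∃ x : ℕ → ℕ, ((fun N => (x N : ℝ)) =o[Filter.atTop] fun N : ℕ => (N : ℝ)) ∧
    ∀ N, a ^ N ≤ 2 ^ x N * b ^ N

/-- The asymptotic LOCC spectrum `Δ(S_k)`: the monotone semiring homomorphisms `S_k → ℝ⁺`. -/
def asympSpectrum (k : ℕ) : Set (LUClass k →+* ℝ≥0) := {f | Monotone f}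

end LOCC

end

open LOCC

/-! There are two independent halves: Strassen's theorem for abstract semirings, and the
verification that LOCC convertibility satisfies its hypotheses (`LOCC.isStrassen`).

Algebra. Imposing one more inequality `a ≤ b` on a Strassen preorder gives a Strassen preorder
again, unless some `n + 1 + s * b ≤ n + s * a` already holds. With Zorn's lemma every Strassen
preorder therefore extends to a total one (`exists_total`). In a total one each element can be
compared with the rationals, which gives a monotone homomorphism to the nonnegative reals (`toHom`).
Now let `f a ≤ f b` for all monotone `f`, with `b ≠ 0`. Imposing `(n + 1) * b ≤ n * a` must fail,
for otherwise some `f` would have `(n + 1) * f b ≤ n * f a ≤ n * f b` with `f b > 0`. The failure is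
itself an inequality in the semiring, from which `c * n² * a ≤ c * (n + 1)² * b` follows with `c ≠
0`. Taking powers, trading `c` for integer bounds and letting `n` grow gives `a ^ N ≤ 2 ^ (C + N /
M) * b ^ N` for every `M`, hence a sublinear exponent. The easy direction takes `N`-th roots
(`le_of_sublinear`).

Quantum part. A pure state spans an extreme ray of the positive cone, so if a channel produces
`|φ⟩⟨φ|` then each of its branches ends in a multiple of `φ`. Convertibility is thus equivalent to
the existence of a finite tree of measurements on vectors, `PConv` (`converts_iff_pconv`). On trees
the axioms are visible. A spectator `χ` in a tensor factor is left alone. A spectator in a direct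
summand is multiplied by the amplitude `q j` of the branch, which the measuring party can do because
the squared moduli sum to one (`PConv.dirSum`). The norm never increases, and `GHZ_d` has squared
norm `d`, so `n + 1 ≤ n` fails. For the Archimedean property, local maps turn a large GHZ state into
a nonzero multiple of any given vector, and a nonzero vector is projected to a nonzero multiple of a
product vector. The scalars are repaired by GHZ states, since `GHZ_2` converts to `√2 |0…0⟩`
(`cls_scalarState_sqrt_two_le`). -/

/-- A Strassen preorder on a commutative semiring: a preorder compatible with the operations,
with `0` as least element, faithful on the natural numbers, and Archimedean. -/
structure IsStrassen {S : Type*} [CommSemiring S] (R : S → S → Prop) : Prop where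
  refl : ∀ a, R a a
  trans : ∀ a b c, R a b → R b c → R a c
  add_right : ∀ a b c, R a b → R (a + c) (b + c)
  mul_right : ∀ a b c, R a b → R (a * c) (b * c)
  zero_le : ∀ a, R 0 a
  not_succ : ∀ n : ℕ, ¬ R (n + 1) n
  arch : ∀ a b, b ≠ 0 → ∃ r : ℕ, R a (r * b)

/-! ### Elementary calculus in a Strassen preorder -/

namespace IsStrassen

variable {S : Type*} [CommSemiring S] {R : S → S → Prop}

theorem add (h : IsStrassen R) {a b c d : S} (h1 : R a b) (h2 : R c d) : R (a + c) (b + d) := by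
  refine h.trans _ _ _ (h.add_right _ _ c h1) ?_
  rw [add_comm b, add_comm b]
  exact h.add_right _ _ b h2

theorem mul_left (h : IsStrassen R) {a b : S} (c : S) (h1 : R a b) : R (c * a) (c * b) := by
  rw [mul_comm c, mul_comm c]
  exact h.mul_right _ _ c h1

theorem mul (h : IsStrassen R) {a b c d : S} (h1 : R a b) (h2 : R c d) : R (a * c) (b * d) :=
  h.trans _ _ _ (h.mul_right _ _ c h1) (h.mul_left b h2)

theorem pow (h : IsStrassen R) {a b : S} (h1 : R a b) (n : ℕ) : R (a ^ n) (b ^ n) := by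
  induction n with
  | zero => simpa using h.refl 1
  | succ n ih => rw [pow_succ, pow_succ]; exact h.mul ih h1

theorem le_add_right (h : IsStrassen R) (a b : S) : R a (a + b) := by
  simpa using h.add (h.refl a) (h.zero_le b)

theorem le_add_left (h : IsStrassen R) (a b : S) : R a (b + a) := by
  simpa using h.add (h.zero_le b) (h.refl a)

theorem natCast_le (h : IsStrassen R) {m n : ℕ} (hmn : m ≤ n) : R (m : S) (n : S) := by
  obtain ⟨l, rfl⟩ := Nat.exists_eq_add_of_le hmn
  push_cast
  exact h.le_add_right _ _

theorem natCast_le_iff (h : IsStrassen R) {m n : ℕ} : R (m : S) (n : S) ↔ m ≤ n := by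
  refine ⟨fun hR => ?_, h.natCast_le⟩
  by_contra! hlt
  refine h.not_succ n (h.trans _ _ _ ?_ hR)
  exact_mod_cast h.natCast_le (Nat.succ_le_of_lt hlt)

theorem natCast_ne_zero (h : IsStrassen R) {n : ℕ} (hn : n ≠ 0) : (n : S) ≠ 0 := by
  intro h0
  have h1 : R ((n : ℕ) : S) ((0 : ℕ) : S) := by
    rw [h0]; simpa using h.refl 0
  exact hn (by simpa using h.natCast_le_iff.1 h1)

theorem one_ne_zero (h : IsStrassen R) : (1 : S) ≠ 0 := by
  simpa using h.natCast_ne_zero (n := 1) (by simp)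

theorem exists_le_natCast (h : IsStrassen R) (a : S) : ∃ r : ℕ, R a r := by
  simpa using h.arch a 1 h.one_ne_zero

theorem ne_zero_of_one_le (h : IsStrassen R) {a : S} (ha : R 1 a) : a ≠ 0 := by
  rintro rfl
  exact h.not_succ 0 (by simpa using ha)

theorem mul_ne_zero (h : IsStrassen R) {a b : S} (ha : a ≠ 0) (hb : b ≠ 0) : a * b ≠ 0 := by
  obtain ⟨r, hr⟩ := h.arch 1 a ha
  obtain ⟨s, hs⟩ := h.arch 1 b hb
  intro h0
  have := h.mul hr hs
  rw [mul_mul_mul_comm, h0, mul_zero, one_mul] at this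
  exact h.ne_zero_of_one_le this rfl

/-- The summand `c` acts as a catalyst: it is returned by each use of the hypothesis, so one copy
serves for `q` exchanges. -/
theorem add_nsmul (h : IsStrassen R) {a b c : S} (hR : R (c + a) (c + b)) (q : ℕ) :
    R (c + q * a) (c + q * b) := by
  induction q with
  | zero => simpa using h.refl c
  | succ q ih =>
    have e1 : c + ((q + 1 : ℕ) : S) * a = (c + a) + q * a := by push_cast; ring
    have e2 : c + ((q + 1 : ℕ) : S) * b = (c + q * b) + b := by push_cast; ring
    have e3 : (c + b) + q * a = (c + q * a) + b := by ring
    rw [e1, e2]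
    refine h.trans _ _ _ (h.add_right _ _ _ hR) ?_
    rw [e3]
    exact h.add_right _ _ _ ih

/-- Iterating would put `Z + q * t` below `Z` for all `q`. But multiples of `t` exceed every natural
number, while `Z` is below some `r`; the choice `q = (r + 1) * u` with `1 ≤ u * t` gives `r + 1 ≤
r`. -/
theorem not_add_le (h : IsStrassen R) {t : S} (ht : t ≠ 0) (Z : S) : ¬ R (t + Z) Z := by
  intro hR
  obtain ⟨r, hr⟩ := h.exists_le_natCast Z
  obtain ⟨u, hu⟩ := h.arch 1 t ht
  have h1 := h.add_nsmul (c := Z) (a := t) (b := 0) (by rwa [add_zero, add_comm]) ((r + 1) * u)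
  have h2 : R ((r : S) + 1) (((r : S) + 1) * (u * t)) := by
    simpa using h.mul_left ((r : S) + 1) hu
  refine h.not_succ r (h.trans _ _ _ h2 (h.trans _ _ _ ?_ (h.trans _ _ _ h1 ?_)))
  · have : (((r + 1) * u : ℕ) : S) * t = ((r : S) + 1) * (u * t) := by push_cast; ring
    rw [this]
    exact h.le_add_left _ _
  · simpa using hr

theorem mul_pow_le (h : IsStrassen R) {c x y : S} (hR : R (c * x) (c * y)) (N : ℕ) :
    R (c * x ^ N) (c * y ^ N) := by
  induction N with
  | zero => simpa using h.refl c
  | succ N ih =>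
    have e1 : c * x ^ (N + 1) = (c * x) * x ^ N := by ring
    have e2 : (c * y) * x ^ N = (c * x ^ N) * y := by ring
    have e3 : c * y ^ (N + 1) = (c * y ^ N) * y := by ring
    rw [e1, e3]
    refine h.trans _ _ _ (h.mul_right _ _ _ hR) ?_
    rw [e2]
    exact h.mul_right _ _ _ ih

/-- The factor `c` survives unchanged in all powers, `c * x ^ N ≤ c * y ^ N`, and bounding it by
integers, `1 ≤ r * c` and `c ≤ s`, costs a constant independent of `N`. -/
theorem cancel_mul (h : IsStrassen R) {c x y : S} (hc : c ≠ 0) (hR : R (c * x) (c * y)) :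
    ∃ C : ℕ, ∀ N : ℕ, R (x ^ N) (C * y ^ N) := by
  have h1 := h.mul_pow_le hR
  obtain ⟨r, hr⟩ := h.arch 1 c hc
  obtain ⟨s, hs⟩ := h.exists_le_natCast c
  refine ⟨r * s, fun N => ?_⟩
  have h2 := h.mul_right _ _ (x ^ N) hr
  rw [one_mul, mul_assoc] at h2
  refine h.trans _ _ _ h2 (h.trans _ _ _ (h.mul_left (r : S) (h1 N)) ?_)
  push_cast
  rw [mul_assoc]
  exact h.mul_left _ (h.mul_right _ _ _ hs)

/-! ### Extension to a total preorder -/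

/-- The relation obtained from `R` by imposing `a ≤ b`. -/
def adjoin (R : S → S → Prop) (a b : S) : S → S → Prop :=
  fun x y => ∃ s, R (x + s * b) (y + s * a)

theorem le_adjoin {a b x y : S} (hxy : R x y) : adjoin R a b x y :=
  ⟨0, by simpa using hxy⟩

theorem adjoin_self (h : IsStrassen R) (a b : S) : adjoin R a b a b :=
  ⟨1, by rw [one_mul, one_mul, add_comm]; exact h.refl _⟩

/-- Witnesses `s` add under transitivity and are multiplied by the factor under multiplication.
Faithfulness on the naturals is the only axiom that can be lost, and it is what `hab` asks for. -/
theorem isStrassen_adjoin (h : IsStrassen R) {a b : S}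
    (hab : ∀ (n : ℕ) (s : S), ¬ R (n + 1 + s * b) (n + s * a)) : IsStrassen (adjoin R a b) where
  refl x := le_adjoin (h.refl x)
  trans := by
    rintro x y z ⟨s, hs⟩ ⟨t, ht⟩
    refine ⟨s + t, ?_⟩
    have h1 := h.add_right _ _ (t * b) hs
    have h2 := h.add_right _ _ (s * a) ht
    have e1 : x + (s + t) * b = x + s * b + t * b := by ring
    have e2 : z + (s + t) * a = z + t * a + s * a := by ring
    have e3 : y + s * a + t * b = y + t * b + s * a := by ring
    rw [e1, e2]
    rw [e3] at h1
    exact h.trans _ _ _ h1 h2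
  add_right := by
    rintro x y z ⟨s, hs⟩
    refine ⟨s, ?_⟩
    have h1 := h.add_right _ _ z hs
    rwa [add_right_comm, add_right_comm y] at h1
  mul_right := by
    rintro x y z ⟨s, hs⟩
    refine ⟨s * z, ?_⟩
    have h1 := h.mul_right _ _ z hs
    have e1 : (x + s * b) * z = x * z + s * z * b := by ring
    have e2 : (y + s * a) * z = y * z + s * z * a := by ring
    rwa [e1, e2] at h1
  zero_le x := le_adjoin (h.zero_le x)
  not_succ n := by
    rintro ⟨s, hs⟩
    exact hab n s hs
  arch x y hy := (h.arch x y hy).imp fun _ => le_adjoin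

/-- A maximal Strassen preorder is total: two incomparable elements would give two obstructions to
enlarging it, and a combination of these is contradictory. -/
theorem exists_total (h : IsStrassen R) :
    ∃ T : S → S → Prop, IsStrassen T ∧ R ≤ T ∧ ∀ a b, T a b ∨ T b a := by
  obtain ⟨T, hRT, hT⟩ := zorn_le_nonempty₀ {T : S → S → Prop | IsStrassen T} (by
    intro c hc hchain T hT
    refine ⟨fun a b => ∃ T ∈ c, T a b, ?_, fun U hU a b hab => ⟨U, hU, hab⟩⟩
    have dir : ∀ {a b a' b' : S}, (∃ T ∈ c, T a b) → (∃ T ∈ c, T a' b') →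
        ∃ T ∈ c, T a b ∧ T a' b' := by
      rintro a b a' b' ⟨U, hU, h1⟩ ⟨V, hV, h2⟩
      rcases hchain.total hU hV with hUV | hVU
      · exact ⟨V, hV, hUV _ _ h1, h2⟩
      · exact ⟨U, hU, h1, hVU _ _ h2⟩
    refine ⟨fun a => ⟨T, hT, (hc hT).refl a⟩, ?_, ?_, ?_, fun a => ⟨T, hT, (hc hT).zero_le a⟩,
      ?_, fun a b hb => ?_⟩
    · intro x y z hxy hyz
      obtain ⟨U, hU, h1, h2⟩ := dir hxy hyz
      exact ⟨U, hU, (hc hU).trans _ _ _ h1 h2⟩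
    · rintro x y z ⟨U, hU, h1⟩
      exact ⟨U, hU, (hc hU).add_right _ _ _ h1⟩
    · rintro x y z ⟨U, hU, h1⟩
      exact ⟨U, hU, (hc hU).mul_right _ _ _ h1⟩
    · rintro n ⟨U, hU, h1⟩
      exact (hc hU).not_succ n h1
    · obtain ⟨r, hr⟩ := (hc hT).arch a b hb
      exact ⟨r, T, hT, hr⟩) R h
  have hTS : IsStrassen T := hT.prop
  -- By maximality, adjoining an inequality that is absent from `T` must violate faithfulness.
  have max : ∀ a b, ¬ T a b → ∃ (n : ℕ) (s : S), T (n + 1 + s * b) (n + s * a) := by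
    intro a b hab
    by_contra! hcon
    exact hab (hT.le_of_ge (y := adjoin T a b) (hTS.isStrassen_adjoin hcon)
      (fun x y => le_adjoin) _ _ (hTS.adjoin_self a b))
  refine ⟨T, hTS, hRT, fun a b => ?_⟩
  by_contra! hcon
  obtain ⟨m, s, hs⟩ := max a b hcon.1
  obtain ⟨n, t, ht⟩ := max b a hcon.2
  by_cases h0 : t + s = 0
  · have ht0 : t = 0 := by
      by_contra hne
      exact hTS.not_add_le hne 0 (by
        rw [add_zero, ← h0]; exact hTS.le_add_right _ _)
    have hs0 : s = 0 := by simpa [ht0] using h0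
    subst hs0
    exact hTS.not_succ m (by simpa using hs)
  -- Weighting each obstruction by the witness of the other makes the terms in `a` and `b` agree on
  -- both sides; what remains is `(t + s) + Z ≤ Z`.
  · have h3 := hTS.add (hTS.mul_left t hs) (hTS.mul_left s ht)
    refine hTS.not_add_le h0 (t * m + s * n + s * t * (a + b)) ?_
    convert h3 using 1 <;> ring

/-! ### The homomorphism of a total Strassen preorder -/

section Total

variable (h : IsStrassen R) (tot : ∀ a b, R a b ∨ R b a)

/-- The value of an element with respect to a total Strassen preorder. -/
noncomputable def val (R : S → S → Prop) (a : S) : ℝ :=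
  sSup {x : ℝ | ∃ p q : ℕ, 0 < q ∧ R p (q * a) ∧ x = p / q}

include h in
theorem div_le_div {a : S} {p q p' q' : ℕ} (hq : 0 < q) (hq' : 0 < q') (h1 : R p (q * a))
    (h2 : R (q' * a) p') : (p : ℝ) / q ≤ (p' : ℝ) / q' := by
  rw [div_le_div_iff₀ (by exact_mod_cast hq) (by exact_mod_cast hq')]
  have h3 := h.mul_left (q' : S) h1
  have h4 := h.mul_left (q : S) h2
  rw [mul_left_comm] at h4
  have h5 := h.trans _ _ _ h3 h4
  have h6 : q' * p ≤ q * p' := by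
    rw [← h.natCast_le_iff]
    exact_mod_cast h5
  rw [mul_comm (p : ℝ), mul_comm (p' : ℝ)]
  exact_mod_cast h6

include h in
theorem exists_upper (a : S) : ∃ p : ℕ, R ((1 : ℕ) * a) p := by
  simpa using h.exists_le_natCast a

include h in
theorem bddAbove_val (a : S) :
    BddAbove {x : ℝ | ∃ p q : ℕ, 0 < q ∧ R p (q * a) ∧ x = p / q} := by
  obtain ⟨r, hr⟩ := h.exists_upper a
  refine ⟨r / (1 : ℕ), ?_⟩
  rintro x ⟨p, q, hq, hp, rfl⟩
  exact h.div_le_div hq one_pos hp hr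

include h in
theorem le_val {a : S} {p q : ℕ} (hq : 0 < q) (h1 : R p (q * a)) : (p : ℝ) / q ≤ val R a :=
  le_csSup (h.bddAbove_val a) ⟨p, q, hq, h1, rfl⟩

include h in
theorem val_le {a : S} {p q : ℕ} (hq : 0 < q) (h1 : R (q * a) p) : val R a ≤ (p : ℝ) / q := by
  refine csSup_le ⟨_, 0, 1, one_pos, by simpa using h.zero_le a, rfl⟩ ?_
  rintro x ⟨p', q', hq', hp, rfl⟩
  exact h.div_le_div hq' hq hp h1

include h in
theorem val_nonneg (a : S) : 0 ≤ val R a := by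
  simpa using h.le_val (p := 0) (q := 1) one_pos (by simpa using h.zero_le a)

include h tot in
-- This is where totality enters: the least integer above `q * a` has a predecessor that is not
-- above it, hence lies below. So `val R a` is known up to `1 / q` from both sides.
theorem exists_floor (a : S) (q : ℕ) : ∃ p : ℕ, R p (q * a) ∧ R (q * a) (p + 1 : ℕ) := by
  classical
  have hex : ∃ p : ℕ, R (q * a) p := h.exists_le_natCast _
  rcases Nat.eq_zero_or_eq_succ_pred (Nat.find hex) with h0 | hs
  · refine ⟨0, by simpa using h.zero_le _, h.trans _ _ _ (Nat.find_spec hex) ?_⟩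
    rw [h0]
    exact h.natCast_le (by omega)
  · refine ⟨(Nat.find hex).pred, ?_, ?_⟩
    · exact (tot _ _).resolve_right (Nat.find_min hex (by omega))
    · have := Nat.find_spec hex
      rwa [hs] at this

include h in
theorem val_natCast (n : ℕ) : val R (n : S) = n := by
  apply le_antisymm
  · simpa using h.val_le (a := (n : S)) (p := n) (q := 1) one_pos (by simpa using h.refl _)
  · simpa using h.le_val (a := (n : S)) (p := n) (q := 1) one_pos (by simpa using h.refl _)

include h in
theorem val_mono {a b : S} (hab : R a b) : val R a ≤ val R b := by
  refine csSup_le ⟨_, 0, 1, one_pos, by simpa using h.zero_le a, rfl⟩ ?_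
  rintro x ⟨p, q, hq, hp, rfl⟩
  exact h.le_val hq (h.trans _ _ _ hp (h.mul_left _ hab))

theorem eq_of_forall_abs_sub_le_div {x y : ℝ} (C : ℝ)
    (hxy : ∀ q : ℕ, 0 < q → |x - y| ≤ C / q) : x = y := by
  have lim : Filter.Tendsto (fun q : ℕ => C / (q : ℝ)) Filter.atTop (nhds 0) :=
    tendsto_const_div_atTop_nhds_zero_nat C
  have := ge_of_tendsto lim (Filter.eventually_atTop.2 ⟨1, fun q hq => hxy q hq⟩)
  exact sub_eq_zero.1 (abs_nonpos_iff.1 this)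

include h tot in
-- Both sides lie between the sum of the two lower approximations and the sum of the two upper ones,
-- which differ by `2 / q`.
theorem val_add (a b : S) : val R (a + b) = val R a + val R b := by
  refine eq_of_forall_abs_sub_le_div 2 fun q hq => ?_
  obtain ⟨p, h1, h2⟩ := h.exists_floor tot a q
  obtain ⟨p', h3, h4⟩ := h.exists_floor tot b q
  have a1 := h.le_val hq h1
  have a2 := h.val_le hq h2
  have a3 := h.le_val hq h3
  have a4 := h.val_le hq h4
  have a5 := h.le_val (a := a + b) (p := p + p') hq (by
    push_cast; rw [mul_add]; exact h.add h1 h3)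
  have a6 := h.val_le (a := a + b) (p := p + 1 + (p' + 1)) hq (by
    rw [mul_add, Nat.cast_add]; exact h.add h2 h4)
  push_cast at a2 a4 a5 a6
  simp only [add_div] at a2 a4 a5 a6
  rw [abs_le]
  have : (2 : ℝ) / q = 1 / q + 1 / q := by ring
  rw [this]
  constructor <;> linarith

include h tot in
theorem val_mul (a b : S) : val R (a * b) = val R a * val R b := by
  -- With lower approximations `x`, `y` and `z = 1 / q ≤ 1`, the error is `(x + z) * (y + z) - x * y
  -- = (x + y + z) * z`, which explains the constant.
  refine eq_of_forall_abs_sub_le_div (val R a + val R b + 1) fun q hq => ?_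
  obtain ⟨p, h1, h2⟩ := h.exists_floor tot a q
  obtain ⟨p', h3, h4⟩ := h.exists_floor tot b q
  have a1 := h.le_val hq h1
  have a2 := h.val_le hq h2
  have a3 := h.le_val hq h3
  have a4 := h.val_le hq h4
  have e : (q : S) * a * (q * b) = (q * q : ℕ) * (a * b) := by push_cast; ring
  have a5 := h.le_val (a := a * b) (p := p * p') (Nat.mul_pos hq hq) (by
    rw [← e, Nat.cast_mul]; exact h.mul h1 h3)
  have a6 := h.val_le (a := a * b) (p := (p + 1) * (p' + 1)) (Nat.mul_pos hq hq) (by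
    rw [← e, Nat.cast_mul]; exact h.mul h2 h4)
  push_cast at a2 a4 a5 a6
  have hq0 : (0 : ℝ) < q := by exact_mod_cast hq
  rw [mul_div_mul_comm] at a5 a6
  rw [add_div] at a2 a4
  have hq1 : (1 : ℝ) / q ≤ 1 := by
    rw [div_le_one hq0]; exact_mod_cast hq
  have hx : (0 : ℝ) ≤ p / q := by positivity
  have hy : (0 : ℝ) ≤ p' / q := by positivity
  have hz : (0 : ℝ) ≤ 1 / q := by positivity
  rw [add_div, add_div _ _ (q : ℝ)] at a6
  generalize (p : ℝ) / q = x at *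
  generalize (p' : ℝ) / q = y at *
  have e2 : (val R a + val R b + 1) / q = (val R a + val R b + 1) * (1 / q) := by ring
  rw [e2]
  generalize (1 : ℝ) / q = z at *
  have b1 : x * y ≤ val R a * val R b := mul_le_mul a1 a3 hy (h.val_nonneg a)
  have b2 : val R a * val R b ≤ (x + z) * (y + z) :=
    mul_le_mul a2 a4 (h.val_nonneg b) (by positivity)
  have b3 : (x + z) * (y + z) - x * y ≤ (val R a + val R b + 1) * z := by
    have e3 : (x + z) * (y + z) - x * y = (x + y + z) * z := by ring
    rw [e3]
    gcongr
  rw [abs_le]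
  constructor <;> linarith

/-- The semiring homomorphism to `[0, ∞)` given by a total Strassen preorder. -/
noncomputable def toHom : S →+* ℝ≥0 where
  toFun a := ⟨val R a, h.val_nonneg a⟩
  map_one' := NNReal.eq (by exact_mod_cast h.val_natCast 1)
  map_zero' := NNReal.eq (by exact_mod_cast h.val_natCast 0)
  map_add' a b := NNReal.eq (h.val_add tot a b)
  map_mul' a b := NNReal.eq (h.val_mul tot a b)

theorem toHom_mono {a b : S} (hab : R a b) : h.toHom tot a ≤ h.toHom tot b :=
  h.val_mono hab

end Total

/-! ### From spectral inequalities to asymptotic ones -/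

/-- If a semiring homomorphism is monotone and `b ≠ 0` then its value at `b` is positive. -/
theorem map_pos (h : IsStrassen R) {f : S →+* ℝ≥0} (hf : ∀ a b, R a b → f a ≤ f b) {b : S}
    (hb : b ≠ 0) : 0 < f b := by
  obtain ⟨r, hr⟩ := h.arch 1 b hb
  have := hf _ _ hr
  rw [map_one, map_mul] at this
  by_contra! hcon
  have : f b = 0 := le_antisymm hcon (by simp)
  simp_all

/-- For each `n` the spectral hypothesis yields a catalysed inequality between `a` and `b` with loss
factor `((n + 1) / n)²`. For large `n` the `M`-th power of this factor is at most `2`, and the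
catalyst cancels up to a constant. -/
theorem exists_growth_bound (h : IsStrassen R) {a b : S} (hb : b ≠ 0)
    (hf : ∀ f : S →+* ℝ≥0, (∀ x y, R x y → f x ≤ f y) → f a ≤ f b) (M : ℕ) :
    ∃ C : ℕ, ∀ N : ℕ, R ((a ^ M) ^ N) (C * (2 * b ^ M) ^ N) := by
  have step : ∀ n : ℕ, ∃ c : S, c ≠ 0 ∧
      R (c * ((n * n : ℕ) * a)) (c * (((n + 1) * (n + 1) : ℕ) * b)) := by
    intro n
    rcases Nat.eq_zero_or_pos n with rfl | hn
    · exact ⟨1, h.one_ne_zero, by simpa using h.zero_le _⟩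
    -- If `n * a` could consistently be imposed above `(n + 1) * b`, a total extension would provide
    -- a homomorphism contradicting `hf`.
    have h1 : ∃ (m : ℕ) (s : S), R (m + 1 + s * (n * a)) (m + s * ((n + 1) * b)) := by
      by_contra! hcon
      obtain ⟨T, hT, hle, tot⟩ := (h.isStrassen_adjoin hcon).exists_total
      have h2 := hT.toHom_mono tot (hle _ _ (h.adjoin_self ((n + 1) * b) (n * a)))
      have h3 := hf (hT.toHom tot) fun x y hxy => hT.toHom_mono tot (hle _ _ (le_adjoin hxy))
      have h4 : 0 < hT.toHom tot b :=
        h.map_pos (fun x y hxy => hT.toHom_mono tot (hle _ _ (le_adjoin hxy))) hb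
      simp only [map_mul, map_add, map_natCast, map_one] at h2
      have h5 : (n : ℝ≥0) * hT.toHom tot a ≤ n * hT.toHom tot b := by gcongr
      have h6 := h2.trans h5
      rw [add_mul, one_mul] at h6
      exact absurd h6 (not_le.2 (lt_add_of_pos_right _ h4))
    obtain ⟨m, s, hs⟩ := h1
    have hs0 : s ≠ 0 := by
      rintro rfl
      exact h.not_succ m (by simpa using hs)
    have hs' : R (m + s * (n * a)) (m + s * ((n + 1) * b)) := by
      refine h.trans _ _ _ ?_ hs
      exact h.add_right _ _ _ (h.le_add_right _ _)
    have hn1 : ((n + 1 : ℕ) : S) ≠ 0 := h.natCast_ne_zero (by omega)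
    -- The leftover `m` on the right is absorbed into `r` copies of `s * ((n + 1) * b)`. Repeating
    -- the exchange `(r + 1) * n` times makes these copies affordable, as `(r + 1) * n + r ≤ (r + 1)
    -- * (n + 1)`; this is the second factor `(n + 1) / n`.
    obtain ⟨r, hr⟩ := h.arch m (s * ((n + 1) * b))
      (h.mul_ne_zero hs0 (h.mul_ne_zero (by exact_mod_cast hn1) hb))
    have h7 := h.add_nsmul hs' ((r + 1) * n)
    refine ⟨(r + 1 : ℕ) * s, h.mul_ne_zero (h.natCast_ne_zero (by omega)) hs0, ?_⟩
    have h8 : R (((r + 1) * n : ℕ) * (s * (n * a)))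
        (((r + 1) * n + r : ℕ) * (s * ((n + 1) * b))) := by
      refine h.trans _ _ _ (h.le_add_left _ m) (h.trans _ _ _ h7 ?_)
      have e : (((r + 1) * n + r : ℕ) : S) * (s * ((n + 1) * b))
          = r * (s * ((n + 1) * b)) + (((r + 1) * n : ℕ) : S) * (s * ((n + 1) * b)) := by
        push_cast; ring
      rw [e]
      exact h.add_right _ _ _ hr
    have e1 : ((r + 1 : ℕ) : S) * s * ((n * n : ℕ) * a)
        = ((r + 1) * n : ℕ) * (s * (n * a)) := by push_cast; ring
    have e2 : ((r + 1 : ℕ) : S) * s * (((n + 1) * (n + 1) : ℕ) * b)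
        = ((r + 1) * (n + 1) : ℕ) * (s * ((n + 1) * b)) := by push_cast; ring
    rw [e1, e2]
    exact h.trans _ _ _ h8 (h.mul_right _ _ _ (h.natCast_le (by ring_nf; omega)))
  have big : ∃ n : ℕ, 0 < n ∧ ((n + 1) * (n + 1)) ^ M ≤ (n * n) ^ M * 2 := by
    have lim : Filter.Tendsto (fun n : ℕ => ((1 + 1 / (n : ℝ)) * (1 + 1 / (n : ℝ))) ^ M)
        Filter.atTop (nhds (((1 + 0) * (1 + 0)) ^ M)) := by
      have := tendsto_one_div_atTop_nhds_zero_nat (𝕜 := ℝ)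
      exact ((this.const_add 1).mul (this.const_add 1)).pow M
    have ev := (lim.eventually_le_const (u := 2) (by norm_num)).and
      (Filter.eventually_gt_atTop 0)
    obtain ⟨n, hn, hn0⟩ := ev.exists
    refine ⟨n, hn0, ?_⟩
    have hn0' : (0 : ℝ) < n := by exact_mod_cast hn0
    have e : ((n : ℝ) + 1) * (n + 1) = (n * n) * ((1 + 1 / (n : ℝ)) * (1 + 1 / (n : ℝ))) := by
      field_simp
    have : (((n : ℝ) + 1) * (n + 1)) ^ M ≤ ((n : ℝ) * n) ^ M * 2 := by
      rw [e, mul_pow]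
      gcongr
    exact_mod_cast this
  obtain ⟨n, hn, hbig⟩ := big
  obtain ⟨c, hc, hR⟩ := step n
  refine h.cancel_mul (c := c * ((n * n) ^ M : ℕ))
    (h.mul_ne_zero hc (h.natCast_ne_zero (by positivity))) ?_
  have h1 := h.mul_pow_le hR M
  rw [mul_pow, mul_pow, ← Nat.cast_pow, ← Nat.cast_pow, ← mul_assoc] at h1
  refine h.trans _ _ _ h1 ?_
  have e : c * (((n * n) ^ M : ℕ) : S) * (2 * b ^ M)
      = c * ((((n * n) ^ M * 2 : ℕ) : S) * b ^ M) := by push_cast; ring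
  rw [e]
  exact h.mul_left _ (h.mul_right _ _ _ (h.natCast_le hbig))

/-- Write `N = M * (N / M) + N % M`. Full blocks of length `M` cost a factor `2` each; the remainder
is handled by the crude bound `a ≤ t * b` and contributes a bounded constant. -/
theorem exists_pow_bound (h : IsStrassen R) {a b : S} (hb : b ≠ 0)
    (hf : ∀ f : S →+* ℝ≥0, (∀ x y, R x y → f x ≤ f y) → f a ≤ f b) {M : ℕ} (hM : 0 < M) :
    ∃ C : ℕ, ∀ N : ℕ, R (a ^ N) (2 ^ (C + N / M) * b ^ N) := by
  obtain ⟨C, hC⟩ := h.exists_growth_bound hb hf M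
  obtain ⟨t, ht⟩ := h.arch a b hb
  -- The base `t + 1` is positive, so its powers are monotone in the exponent even when `t = 0`. The
  -- constant becomes an exponent through `n ≤ 2 ^ n`.
  refine ⟨C * (t + 1) ^ M, fun N => ?_⟩
  have h1 := h.pow ht (N % M)
  have h2 := h.mul (hC (N / M)) h1
  rw [← pow_mul, ← pow_add, Nat.div_add_mod] at h2
  refine h.trans _ _ _ h2 ?_
  have e1 : (C : S) * (2 * b ^ M) ^ (N / M) * (t * b) ^ (N % M)
      = (C * 2 ^ (N / M) * t ^ (N % M) : ℕ) * b ^ N := by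
    conv_rhs => rw [← Nat.div_add_mod N M, pow_add, pow_mul]
    rw [Nat.div_add_mod]
    push_cast
    ring
  have e2 : (2 : S) ^ (C * (t + 1) ^ M + N / M) = (2 ^ (C * (t + 1) ^ M + N / M) : ℕ) := by
    push_cast; rfl
  rw [e1, e2]
  refine h.mul_right _ _ _ (h.natCast_le ?_)
  have h3 : t ^ (N % M) ≤ (t + 1) ^ M :=
    (Nat.pow_le_pow_left (Nat.le_succ t) _).trans
      (Nat.pow_le_pow_right (Nat.succ_pos t) (Nat.mod_lt _ hM).le)
  calc C * 2 ^ (N / M) * t ^ (N % M) ≤ C * 2 ^ (N / M) * (t + 1) ^ M := by gcongr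
    _ = (C * (t + 1) ^ M) * 2 ^ (N / M) := by ring
    _ ≤ 2 ^ (C * (t + 1) ^ M) * 2 ^ (N / M) := by
        gcongr
        exact Nat.lt_two_pow_self.le
    _ = _ := by rw [pow_add]

/-- Strassen's theorem, the hard direction: an inequality for all monotone homomorphisms to
`[0, ∞)` implies the asymptotic inequality. -/
theorem exists_sublinear (h : IsStrassen R) {a b : S}
    (hf : ∀ f : S →+* ℝ≥0, (∀ x y, R x y → f x ≤ f y) → f a ≤ f b) :
    ∃ x : ℕ → ℕ, ((fun N => (x N : ℝ)) =o[Filter.atTop] fun N : ℕ => (N : ℝ)) ∧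
      ∀ N, R (a ^ N) (2 ^ x N * b ^ N) := by
  classical
  by_cases hb : b = 0
  -- A nonzero `a` would be positive under the homomorphism of any total extension, against `f a ≤ f
  -- 0 = 0`.
  · have ha : a = 0 := by
      by_contra ha
      obtain ⟨T, hT, hle, tot⟩ := h.exists_total
      have h1 := hf (hT.toHom tot) fun x y hxy => hT.toHom_mono tot (hle _ _ hxy)
      have h2 := hT.map_pos (fun x y hxy => hT.toHom_mono tot hxy) ha
      rw [hb, map_zero] at h1
      exact absurd h1 (not_le.2 h2)
    refine ⟨0, by simp, fun N => ?_⟩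
    rw [ha, hb]
    simpa using h.refl _
  have hex : ∀ N : ℕ, ∃ x : ℕ, R (a ^ N) (2 ^ x * b ^ N) := fun N => by
    obtain ⟨C, hC⟩ := h.exists_pow_bound hb hf one_pos
    exact ⟨_, hC N⟩
  -- Taking the least exponent for each `N` lets one sequence satisfy the bounds `C + N / M` for all
  -- `M` simultaneously.
  refine ⟨fun N => Nat.find (hex N), ?_, fun N => Nat.find_spec (hex N)⟩
  rw [Asymptotics.isLittleO_iff]
  intro ε hε
  obtain ⟨M, hM⟩ := exists_nat_gt (2 / ε)
  have hM0 : (0 : ℝ) < M := (by positivity : 0 < 2 / ε).trans hM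
  obtain ⟨C, hC⟩ := h.exists_pow_bound hb hf (M := M) (by exact_mod_cast hM0)
  obtain ⟨K, hK⟩ := exists_nat_gt (2 * C / ε)
  filter_upwards [Filter.eventually_ge_atTop K] with N hN
  have h1 : Nat.find (hex N) ≤ C + N / M := Nat.find_min' _ (hC N)
  have h2 : (Nat.find (hex N) : ℝ) ≤ C + (N : ℝ) / M := by
    refine (Nat.cast_le.2 h1).trans ?_
    push_cast
    gcongr
    exact Nat.cast_div_le
  have h3 : (C : ℝ) ≤ ε / 2 * N := by
    have : 2 * C / ε < (N : ℝ) := hK.trans_le (by exact_mod_cast hN)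
    rw [div_lt_iff₀ hε] at this
    linarith
  have h4 : (N : ℝ) / M ≤ ε / 2 * N := by
    rw [div_le_iff₀ hM0]
    rw [div_lt_iff₀ hε] at hM
    have : (0 : ℝ) ≤ N := Nat.cast_nonneg _
    nlinarith
  simp only [Real.norm_natCast]
  linarith

/-- After `N`-th roots the factor is `2 ^ (x N / N)`, which tends to `1`. -/
theorem le_of_sublinear {u v : ℝ≥0} {x : ℕ → ℕ}
    (hx : (fun N => (x N : ℝ)) =o[Filter.atTop] fun N : ℕ => (N : ℝ))
    (huv : ∀ N, u ^ N ≤ 2 ^ x N * v ^ N) : u ≤ v := by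
  have lim : Filter.Tendsto (fun N : ℕ => (2 : ℝ) ^ ((x N : ℝ) / N) * v) Filter.atTop
      (nhds (2 ^ (0 : ℝ) * v)) :=
    (tendsto_const_nhds.rpow hx.tendsto_div_nhds_zero (Or.inl (by norm_num))).mul_const _
  rw [Real.rpow_zero, one_mul] at lim
  refine NNReal.coe_le_coe.1 (ge_of_tendsto lim ?_)
  filter_upwards [Filter.eventually_gt_atTop 0] with N hN
  refine le_of_pow_le_pow_left₀ hN.ne' (by positivity) ?_
  rw [mul_pow, ← Real.rpow_mul_natCast (by norm_num), div_mul_cancel₀ _ (by positivity),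
    Real.rpow_natCast]
  exact_mod_cast huv N

end IsStrassen

noncomputable section

namespace LOCC

/-! ### Contractions and product operators -/

/-- The Kraus operators `K j` satisfy `∑ j, K j* K j ≤ 1`. -/
def IsKraus {m n J : Type*} [Fintype m] [Fintype n] [DecidableEq n] [Fintype J]
    (K : J → Matrix m n ℂ) : Prop :=
  (1 - ∑ j, (K j)ᴴ * K j).PosSemidef

/-- The operator `A` is a contraction. -/
def IsContr {m n : Type*} [Fintype m] [Fintype n] [DecidableEq n] (A : Matrix m n ℂ) : Prop :=
  (1 - Aᴴ * A).PosSemidef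

section Contr

variable {m n : Type*} [Fintype m] [Fintype n] [DecidableEq n]

theorem isKraus_unit {A : Matrix m n ℂ} (hA : IsContr A) : IsKraus (fun _ : Unit => A) := by
  simpa [IsKraus, IsContr] using hA

theorem isContr_of_isKraus {A : Matrix m n ℂ} (hA : IsKraus (fun _ : Unit => A)) : IsContr A := by
  simpa [IsKraus, IsContr] using hA

theorem isContr_of_isometry {A : Matrix m n ℂ} (hA : Aᴴ * A = 1) : IsContr A := by
  rw [IsContr, hA, sub_self]
  exact Matrix.PosSemidef.zero

theorem isContr_one : IsContr (1 : Matrix n n ℂ) := isContr_of_isometry (by simp)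

theorem isContr_zero : IsContr (0 : Matrix m n ℂ) := by
  simpa [IsContr] using Matrix.PosSemidef.one

theorem exists_eq_conjTranspose_mul_self {P : Matrix n n ℂ} (hP : P.PosSemidef) :
    ∃ B : Matrix n n ℂ, P = Bᴴ * B := by
  open scoped Matrix.Norms.L2Operator MatrixOrder in
  exact CStarAlgebra.nonneg_iff_eq_star_mul_self.mp hP.nonneg

end Contr

section Product

variable {k : ℕ} {c d e : Fin k → ℕ}

theorem tensorOp_conjTranspose (A : ∀ j, Matrix (Fin (e j)) (Fin (d j)) ℂ) :
    (tensorOp A)ᴴ = tensorOp (fun j => (A j)ᴴ) := by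
  ext x y
  simp [tensorOp, Matrix.conjTranspose_apply]

theorem tensorOp_posSemidef {P : ∀ j, Matrix (Fin (d j)) (Fin (d j)) ℂ}
    (hP : ∀ j, (P j).PosSemidef) : (tensorOp P).PosSemidef := by
  choose B hB using fun j => exists_eq_conjTranspose_mul_self (hP j)
  have : tensorOp P = (tensorOp B)ᴴ * tensorOp B := by
    rw [tensorOp_conjTranspose, tensorOp_mul]
    exact congrArg tensorOp (funext hB)
  rw [this]
  exact Matrix.posSemidef_conjTranspose_mul_self _

theorem tensorOp_update_apply (P : ∀ j, Matrix (Fin (e j)) (Fin (d j)) ℂ) (i : Fin k)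
    (X : Matrix (Fin (e i)) (Fin (d i)) ℂ) (x : Idx e) (y : Idx d) :
    tensorOp (Function.update P i X) x y
      = X (x i) (y i) * ∏ l ∈ Finset.univ.erase i, P l (x l) (y l) := by
  rw [tensorOp, ← Finset.mul_prod_erase _ _ (Finset.mem_univ i), Function.update_self]
  congr 1
  refine Finset.prod_congr rfl fun l hl => ?_
  rw [Function.update_of_ne (Finset.ne_of_mem_erase hl)]

theorem tensorOp_update_sub (P : ∀ j, Matrix (Fin (e j)) (Fin (d j)) ℂ) (i : Fin k)
    (X Y : Matrix (Fin (e i)) (Fin (d i)) ℂ) :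
    tensorOp (Function.update P i (X - Y))
      = tensorOp (Function.update P i X) - tensorOp (Function.update P i Y) := by
  ext x y
  simp only [tensorOp_update_apply, Matrix.sub_apply, sub_mul]

theorem tensorOp_update_sum {J : Type*} [Fintype J] (P : ∀ j, Matrix (Fin (e j)) (Fin (d j)) ℂ)
    (i : Fin k) (X : J → Matrix (Fin (e i)) (Fin (d i)) ℂ) :
    tensorOp (Function.update P i (∑ j, X j)) = ∑ j, tensorOp (Function.update P i (X j)) := by
  ext x y
  simp only [tensorOp_update_apply, Matrix.sum_apply, Finset.sum_mul]

theorem tensorOp_eq_zero (A : ∀ j, Matrix (Fin (e j)) (Fin (d j)) ℂ) (i : Fin k) (hA : A i = 0) :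
    tensorOp A = 0 := by
  ext x y
  exact Finset.prod_eq_zero (Finset.mem_univ i) (by simp [hA])

/-- Replacing one factor `P i` by `1` changes the product by a tensor product of positive operators
with `1 - P i` in place `i`; the replacements are made one at a time. -/
theorem tensorOp_sub_posSemidef {P : ∀ j, Matrix (Fin (d j)) (Fin (d j)) ℂ}
    (hP : ∀ j, (P j).PosSemidef) (s : Finset (Fin k)) (hs : ∀ j ∈ s, (1 - P j).PosSemidef) :
    (tensorOp (fun j => if j ∈ s then 1 else P j) - tensorOp P).PosSemidef := by
  classical
  induction s using Finset.induction_on with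
  | empty => simpa using Matrix.PosSemidef.zero
  | insert i s hi ih =>
    have h1 := ih fun j hj => hs j (Finset.mem_insert_of_mem hj)
    let Q : ∀ j, Matrix (Fin (d j)) (Fin (d j)) ℂ := fun j => if j ∈ s then 1 else P j
    have e1 : (fun j => if j ∈ insert i s then 1 else P j) = Function.update Q i 1 := by
      funext j
      by_cases hj : j = i
      · subst hj; simp
      · simp [hj, Q]
    have e2 : Q = Function.update Q i (P i) := by simp [Q, hi]
    have h2 : (tensorOp (Function.update Q i 1) - tensorOp Q).PosSemidef := by
      conv in tensorOp Q => rw [e2]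
      rw [← tensorOp_update_sub]
      refine tensorOp_posSemidef fun j => ?_
      by_cases hj : j = i
      · subst hj
        simpa using hs j (Finset.mem_insert_self _ _)
      · rw [Function.update_of_ne hj]
        simp only [Q]
        split_ifs
        · exact Matrix.PosSemidef.one
        · exact hP j
    rw [e1]
    have := h2.add h1
    rwa [sub_add_sub_cancel] at this

/-- Contractions of the other parties only decrease each `(A j)ᴴ * A j`, even if they depend on the
outcome, so the sum is bounded by that of the measuring party alone. -/
theorem isKraus_tensorOp {J : Type*} [Fintype J] (i : Fin k)
    (A : J → ∀ l, Matrix (Fin (e l)) (Fin (d l)) ℂ)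
    (hA : ∀ j l, l ≠ i → IsContr (A j l)) (hi : IsKraus fun j => A j i) :
    IsKraus fun j => tensorOp (A j) := by
  classical
  let P : J → ∀ l, Matrix (Fin (d l)) (Fin (d l)) ℂ := fun j l => (A j l)ᴴ * A j l
  have hP : ∀ j l, (P j l).PosSemidef := fun j l => Matrix.posSemidef_conjTranspose_mul_self _
  have h1 : ∀ j, (tensorOp (Function.update (fun _ => 1) i (P j i)) - tensorOp (P j)).PosSemidef := by
    intro j
    have := tensorOp_sub_posSemidef (hP j) (Finset.univ.erase i)
      fun l hl => hA j l (Finset.ne_of_mem_erase hl)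
    convert this using 3
    funext l
    by_cases hl : l = i
    · subst hl; simp
    · simp [hl]
  have h2 : (1 - ∑ j, tensorOp (Function.update (fun l => (1 : Matrix (Fin (d l)) (Fin (d l)) ℂ))
      i (P j i))).PosSemidef := by
    have e1 : (1 : Matrix (Idx d) (Idx d) ℂ)
        = tensorOp (Function.update (fun l => (1 : Matrix (Fin (d l)) (Fin (d l)) ℂ)) i 1) := by
      rw [← tensorOp_one]
      congr 1
      exact (Function.update_eq_self i _).symm
    rw [← tensorOp_update_sum, e1, ← tensorOp_update_sub]
    refine tensorOp_posSemidef fun l => ?_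
    by_cases hl : l = i
    · subst hl
      rw [Function.update_self]
      exact hi
    · rw [Function.update_of_ne hl]
      exact Matrix.PosSemidef.one
  have h3 := h2.add (Matrix.posSemidef_sum Finset.univ fun j _ => h1 j)
  rw [Finset.sum_sub_distrib, sub_add_sub_cancel] at h3
  simpa only [IsKraus, tensorOp_conjTranspose, tensorOp_mul] using h3

end Product

/-- The squared norm of a vector. -/
def normSqVec {n : Type*} [Fintype n] (v : n → ℂ) : ℝ := ∑ x, ‖v x‖ ^ 2

section normSqVec

variable {m n J : Type*} [Fintype m] [Fintype n] [Fintype J]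

theorem normSqVec_eq (v : n → ℂ) : (normSqVec v : ℂ) = star v ⬝ᵥ v := by
  simp only [normSqVec, dotProduct, Pi.star_apply, RCLike.star_def, Complex.conj_mul']
  push_cast
  rfl

theorem normSqVec_smul (q : ℂ) (v : n → ℂ) : normSqVec (q • v) = ‖q‖ ^ 2 * normSqVec v := by
  simp [normSqVec, mul_pow, Finset.mul_sum]

theorem IsKraus.sum_normSqVec_le [DecidableEq n] {K : J → Matrix m n ℂ} (hK : IsKraus K)
    (v : n → ℂ) : ∑ j, normSqVec (K j *ᵥ v) ≤ normSqVec v := by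
  have h1 := hK.dotProduct_mulVec_nonneg v
  rw [Matrix.sub_mulVec, Matrix.one_mulVec, dotProduct_sub, sub_nonneg, Matrix.sum_mulVec,
    dotProduct_sum] at h1
  have h2 : ∀ j, star v ⬝ᵥ ((K j)ᴴ * K j) *ᵥ v = (normSqVec (K j *ᵥ v) : ℂ) := by
    intro j
    rw [normSqVec_eq, ← Matrix.mulVec_mulVec, Matrix.star_mulVec, Matrix.dotProduct_mulVec]
  simp only [h2, ← normSqVec_eq] at h1
  exact_mod_cast h1

end normSqVec

/-! ### Pure conversion trees -/

/-- Conversion of vectors by an LOCC protocol all of whose branches are pure: one party measures,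
the other parties apply contractions depending on the outcome, and the protocol continues with a
conversion to a multiple `q j • w` of the target, with `∑ j, |q j|² = 1`. -/
inductive PConv {k : ℕ} : ∀ {d e : Fin k → ℕ}, (Idx d → ℂ) → (Idx e → ℂ) → Prop
  | refl {d : Fin k → ℕ} (v : Idx d → ℂ) : PConv v v
  | step {c d e : Fin k → ℕ} {v : Idx d → ℂ} {w : Idx e → ℂ} (i : Fin k) (J : Type) [Fintype J]
      (A : J → ∀ l, Matrix (Fin (c l)) (Fin (d l)) ℂ) (q : J → ℂ)
      (hq : ∑ j, ‖q j‖ ^ 2 = 1) (hA : ∀ j l, l ≠ i → IsContr (A j l))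
      (hi : IsKraus fun j => A j i) (next : ∀ j, PConv (tensorOp (A j) *ᵥ v) (q j • w)) :
      PConv v w

namespace PConv

variable {k : ℕ} {c d e : Fin k → ℕ}

theorem of_smul (i : Fin k) (A : ∀ l, Matrix (Fin (c l)) (Fin (d l)) ℂ) (hA : ∀ l, IsContr (A l))
    {v : Idx d → ℂ} {w : Idx e → ℂ} {q : ℂ} (hq : ‖q‖ = 1)
    (h : PConv (tensorOp A *ᵥ v) (q • w)) : PConv v w :=
  step i Unit (fun _ => A) (fun _ => q) (by simp [hq]) (fun _ l _ => hA l) (isKraus_unit (hA i))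
    fun _ => h

theorem of_isContr (i : Fin k) (A : ∀ l, Matrix (Fin (c l)) (Fin (d l)) ℂ)
    (hA : ∀ l, IsContr (A l)) (v : Idx d → ℂ) : PConv v (tensorOp A *ᵥ v) :=
  of_smul i A hA (q := 1) (by simp) (by rw [one_smul]; exact refl _)

theorem zero (i : Fin k) (v : Idx d → ℂ) : PConv v (0 : Idx e → ℂ) := by
  have := of_isContr i (fun l => (0 : Matrix (Fin (e l)) (Fin (d l)) ℂ)) (fun l => isContr_zero) v
  rwa [tensorOp_eq_zero _ i rfl, Matrix.zero_mulVec] at this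

theorem of_phase (i : Fin k) {v : Idx d → ℂ} {w : Idx e → ℂ} {q : ℂ} (hq : ‖q‖ = 1)
    (h : PConv v (q • w)) : PConv v w :=
  of_smul i (fun _ => 1) (fun _ => isContr_one) hq (by rwa [tensorOp_one, Matrix.one_mulVec])

/-- The weights `‖q j‖ ^ 2` sum to one, so the total squared norm over the branches is that of the
target, while each measurement does not increase the total. -/
theorem normSqVec_le {v : Idx d → ℂ} {w : Idx e → ℂ} (h : PConv v w) :
    normSqVec w ≤ normSqVec v := by
  induction h with
  | refl => exact le_rfl
  | @step c d e v w i J _ A q hq hA hi next ih =>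
    refine le_trans ?_ ((isKraus_tensorOp i A hA hi).sum_normSqVec_le v)
    calc normSqVec w = ∑ j, normSqVec (q j • w) := by
          simp only [normSqVec_smul, ← Finset.sum_mul, hq, one_mul]
      _ ≤ _ := Finset.sum_le_sum fun j _ => ih j

/-- The operators are block diagonal, so the defect from `1` is the orthogonal sum of the two
defects. -/
theorem isKraus_dirSum {J : Type*} [Fintype J] {a b a' b' : ℕ}
    {A : J → Matrix (Fin a') (Fin a) ℂ} {B : J → Matrix (Fin b') (Fin b) ℂ} (hA : IsKraus A)
    (hB : IsKraus B) : IsKraus fun j =>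
      inclL a' b' * (A j * (inclL a b)ᴴ) + inclR a' b' * (B j * (inclR a b)ᴴ) := by
  have r {m a b : ℕ} {X : Matrix (Fin m) (Fin a) ℂ} {Y : Matrix (Fin m) (Fin b) ℂ}
      {Z : Matrix (Fin a) (Fin b) ℂ} (h : Xᴴ * Y = Z) {c : ℕ} (M : Matrix (Fin b) (Fin c) ℂ) :
      Xᴴ * (Y * M) = Z * M := by
    rw [← Matrix.mul_assoc, h]
  have h1 := (hA.mul_mul_conjTranspose_same (inclL a b)).add
    (hB.mul_mul_conjTranspose_same (inclR a b))
  rw [IsKraus]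
  convert h1 using 1
  rw [← incl_total a b]
  simp only [Matrix.conjTranspose_add, Matrix.conjTranspose_mul,
    Matrix.conjTranspose_conjTranspose, Matrix.add_mul, Matrix.mul_add, Matrix.mul_assoc,
    r (inclL_isometry _ _), r (inclR_isometry _ _), r (inclL_orth _ _), r (inclR_orth _ _),
    Matrix.mul_zero, Matrix.zero_mul, Matrix.one_mul, add_zero, zero_add, Matrix.mul_sub,
    Matrix.sub_mul, Matrix.mul_one, Matrix.sum_mul, Matrix.mul_sum, Finset.sum_add_distrib]
  abel

theorem isContr_dirSum {a b a' b' : ℕ}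
    {A : Matrix (Fin a') (Fin a) ℂ} {B : Matrix (Fin b') (Fin b) ℂ} (hA : IsContr A)
    (hB : IsContr B) : IsContr
      (inclL a' b' * (A * (inclL a b)ᴴ) + inclR a' b' * (B * (inclR a b)ᴴ)) :=
  isContr_of_isKraus (isKraus_dirSum (isKraus_unit hA) (isKraus_unit hB))

theorem dirSumVec_smul (q : ℂ) (v : Idx d → ℂ) (w : Idx e → ℂ) :
    dirSumVec (q • v) (q • w) = q • dirSumVec v w := by
  simp [dirSumVec, Matrix.mulVec_smul]

/-- On the summand `χ` the measurement is simulated by the scalars `q j`, so that in branch `j` both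
summands carry the same factor and the target is `q j` times the direct sum. The induction needs `χ`
arbitrary, because the branch continues with `q j • χ`. -/
theorem dirSum {v : Idx d → ℂ} {w : Idx e → ℂ} (h : PConv v w) {f : Fin k → ℕ} (χ : Idx f → ℂ) :
    PConv (dirSumVec v χ) (dirSumVec w χ) := by
  classical
  induction h generalizing χ with
  | refl => exact refl _
  | @step c d e v w i J _ A q hq hA hi next ih =>
    -- Only the measuring party applies the scalar, so `χ` is multiplied by it exactly once; `hq`
    -- makes these operators a complete measurement.
    let B : J → ∀ l, Matrix (Fin (f l)) (Fin (f l)) ℂ := fun j =>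
      Function.update (fun _ => 1) i (q j • 1)
    have hB : ∀ j, tensorOp (B j) *ᵥ χ = q j • χ := by
      intro j
      ext x
      rw [tensorOp_single, Finset.sum_eq_single (x i)]
      · simp
      · intro a _ ha
        simp [Matrix.one_apply_ne ha.symm]
      · simp
    refine step i J (fun j l => inclL (c l) (f l) * (A j l * (inclL (d l) (f l))ᴴ)
      + inclR (c l) (f l) * (B j l * (inclR (d l) (f l))ᴴ)) q hq
      (fun j l hl => isContr_dirSum (hA j l hl) (B := B j l) ?_)
      (isKraus_dirSum hi (B := fun j => B j i) ?_) fun j => ?_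
    · simp only [B, Function.update_of_ne hl]
      exact isContr_one
    · have : ∑ j, (B j i)ᴴ * B j i = 1 := by
        have h1 : ∀ j, (B j i)ᴴ * B j i
            = ((‖q j‖ ^ 2 : ℝ) : ℂ) • (1 : Matrix (Fin (f i)) (Fin (f i)) ℂ) := by
          intro j
          simp only [B, Function.update_self]
          rw [Matrix.conjTranspose_smul, Matrix.conjTranspose_one, smul_mul_smul_comm, one_mul,
            RCLike.star_def, Complex.conj_mul']
          push_cast
          rfl
        simp only [h1]
        rw [← Finset.sum_smul, ← Complex.ofReal_sum, hq]
        simp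
      rw [IsKraus, this, sub_self]
      exact Matrix.PosSemidef.zero
    · have h1 := ih j (q j • χ)
      rw [dirSumVec_smul] at h1
      rwa [LUVec.dirSum_congr_aux (A j) (B j) rfl (hB j).symm] at h1

/-- Writing the defect of `A` as `Bᴴ * B`, the new defect is the square of `B` tensored with the
identity. -/
theorem isKraus_localKron {J : Type*} [Fintype J] {a a' : ℕ} (b : ℕ)
    {A : J → Matrix (Fin a') (Fin a) ℂ} (hA : IsKraus A) :
    IsKraus fun j => localKron (A j) (1 : Matrix (Fin b) (Fin b) ℂ) := by
  obtain ⟨B, hB⟩ := exists_eq_conjTranspose_mul_self hA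
  have h1 : 1 - ∑ j, (localKron (A j) (1 : Matrix (Fin b) (Fin b) ℂ))ᴴ
        * localKron (A j) (1 : Matrix (Fin b) (Fin b) ℂ)
      = (localKron B (1 : Matrix (Fin b) (Fin b) ℂ))ᴴ * localKron B 1 := by
    simp only [localKron_conjTranspose, localKron_mul, ← hB, Matrix.conjTranspose_one,
      Matrix.one_mul]
    rw [← localKron_one]
    ext x y
    simp only [localKron, Matrix.sub_apply, Matrix.sum_apply, sub_mul, Finset.sum_mul]
  rw [IsKraus, h1]
  exact Matrix.posSemidef_conjTranspose_mul_self _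

theorem isContr_localKron {a a' : ℕ} (b : ℕ) {A : Matrix (Fin a') (Fin a) ℂ} (hA : IsContr A) :
    IsContr (localKron A (1 : Matrix (Fin b) (Fin b) ℂ)) :=
  isContr_of_isKraus (isKraus_localKron b (isKraus_unit hA))

theorem tensorVec_smul (q : ℂ) (v : Idx d → ℂ) (w : Idx e → ℂ) :
    tensorVec (q • v) w = q • tensorVec v w := by
  ext x
  simp [tensorVec, mul_assoc]

theorem tensor {v : Idx d → ℂ} {w : Idx e → ℂ} (h : PConv v w) {f : Fin k → ℕ} (χ : Idx f → ℂ) :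
    PConv (tensorVec v χ) (tensorVec w χ) := by
  induction h with
  | refl => exact refl _
  | @step c d e v w i J _ A q hq hA hi next ih =>
    refine step i J (fun j l => localKron (A j l) 1) q hq
      (fun j l hl => isContr_localKron _ (hA j l hl)) (isKraus_localKron _ hi) fun j => ?_
    have h1 := ih j
    rw [tensorVec_smul] at h1
    rwa [tensorOp_localKron, tensorOp_one, Matrix.one_mulVec]

end PConv

/-! ### LOCC channels on pure ensembles -/

/-- The matrix identifying the common initial basis vectors of `ℂ^n` and `ℂ^m`. -/
def castMat (m n : ℕ) : Matrix (Fin m) (Fin n) ℂ := fun x y => if (x : ℕ) = (y : ℕ) then 1 else 0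

theorem castMat_isometry {m n : ℕ} (h : n ≤ m) : (castMat m n)ᴴ * castMat m n = 1 := by
  have : castMat m n = basisMap (Fin.castLE h) := by
    ext x y
    simp [castMat, basisMap, Fin.ext_iff]
  rw [this]
  exact basisMap_isometry (Fin.castLE_injective h)

theorem castMat_self (n : ℕ) : castMat n n = 1 := by
  ext x y
  simp [castMat, Matrix.one_apply, Fin.ext_iff]

section Ensemble

variable {k : ℕ}

theorem actAt_eq_tensorOp {d e : Fin k → ℕ} (i : Fin k) (K : Matrix (Fin (e i)) (Fin (d i)) ℂ) :
    actAt i K = tensorOp (Function.update (fun l => castMat (e l) (d l)) i K) := by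
  ext x y
  rw [tensorOp_update_apply]
  simp only [actAt, castMat, Finset.prod_ite_zero]
  simp

/-- The vector `|v⟩ ⊗ |x⟩`. -/
def ket {A : StateSpace k} (v : Idx A.dim → ℂ) (x : A.Reg) : Idx A.dim × A.Reg → ℂ :=
  fun p => if p.2 = x then v p.1 else 0

/-- The operator `|v⟩⟨v| ⊗ |x⟩⟨x|`. -/
def pureOp {A : StateSpace k} (v : Idx A.dim → ℂ) (x : A.Reg) : A.Op :=
  Matrix.vecMulVec (ket v x) (star (ket v x))

theorem pureOp_apply {A : StateSpace k} (v : Idx A.dim → ℂ) (x : A.Reg) (p r : Idx A.dim × A.Reg) :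
    pureOp v x p r = (if p.2 = x then v p.1 else 0) * star (if r.2 = x then v r.1 else 0) :=
  rfl

theorem pureOp_zero {A : StateSpace k} (x : A.Reg) : pureOp (0 : Idx A.dim → ℂ) x = 0 := by
  ext p r
  simp [pureOp_apply]

theorem pureOp_smul {A : StateSpace k} (q : ℂ) (v : Idx A.dim → ℂ) (x : A.Reg) :
    pureOp (q • v) x = ((‖q‖ ^ 2 : ℝ) : ℂ) • pureOp v x := by
  have h : ket (q • v) x = q • ket v x := by
    ext p
    simp [ket]
  rw [pureOp, h, star_smul, Matrix.vecMulVec_smul, Matrix.smul_vecMulVec, smul_smul, pureOp,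
    RCLike.star_def, Complex.conj_mul']
  push_cast
  rfl

theorem pureOp_space_apply (ψ : PureState k) (v : Idx ψ.dim → ℂ) (x : Unit)
    (p r : Idx ψ.dim × Unit) :
    pureOp (A := ψ.space) v x p r = v p.1 * star (v r.1) :=
  (pureOp_apply (A := ψ.space) v x p r).trans
    (congrArg₂ (fun a b => a * star b) (if_pos rfl) (if_pos rfl))

theorem density_eq (ψ : PureState k) : ψ.density = pureOp (A := ψ.space) ψ.amp () := by
  ext p r
  exact (pureOp_space_apply ψ ψ.amp () p r).symm

theorem op_mulVec_ket {A B : StateSpace k} (Λ : OneStep A B) (j : Λ.J) (v : Idx A.dim → ℂ)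
    (x : A.Reg) : Λ.op j *ᵥ ket v x
      = ket (actAt (d := A.dim) (e := B.dim) Λ.party (if Λ.f j = x then Λ.kraus j else 0) *ᵥ v)
        (Λ.g j) := by
  ext p
  obtain ⟨p, y⟩ := p
  simp only [Matrix.mulVec, dotProduct, OneStep.op, Matrix.kroneckerMap_apply, ket,
    Fintype.sum_prod_type, Matrix.single_apply]
  by_cases hf : Λ.f j = x
  · by_cases hg : y = Λ.g j
    · subst hg
      simp [hf]
    · simp [hg, Ne.symm hg]
  · have : ∀ q, actAt (d := A.dim) (e := B.dim) Λ.party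
        (0 : Matrix (Fin (B.dim Λ.party)) (Fin (A.dim Λ.party)) ℂ) p q = 0 := by
      intro q
      simp [actAt]
    simp [hf, this]

theorem apply_pureOp {A B : StateSpace k} (Λ : OneStep A B) (v : Idx A.dim → ℂ) (x : A.Reg) :
    Λ.apply (pureOp v x) = ∑ j, pureOp (actAt (d := A.dim) (e := B.dim) Λ.party
      (if Λ.f j = x then Λ.kraus j else 0) *ᵥ v) (Λ.g j) := by
  rw [OneStep.apply]
  refine Finset.sum_congr rfl fun j _ => ?_
  rw [pureOp, Matrix.mul_vecMulVec, Matrix.vecMulVec_mul, ← Matrix.star_mulVec, op_mulVec_ket]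
  rfl

theorem apply_sum {A B : StateSpace k} (Λ : OneStep A B) {ι : Type*} (s : Finset ι)
    (ρ : ι → A.Op) : Λ.apply (∑ a ∈ s, ρ a) = ∑ a ∈ s, Λ.apply (ρ a) := by
  simp only [OneStep.apply, Matrix.mul_sum, Matrix.sum_mul]
  rw [Finset.sum_comm]

/-- Compression of the channel condition to the diagonal block of the register value `x`. -/
theorem isKraus_fiber {A B : StateSpace k} (Λ : OneStep A B) (x : A.Reg) :
    IsKraus fun j => if Λ.f j = x then Λ.kraus j else 0 := by
  have h := Λ.kraus_le.submatrix (fun a => (a, x))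
  rw [IsKraus]
  convert h using 1
  ext a b
  simp only [Matrix.sub_apply, Matrix.submatrix_apply, Matrix.sum_apply,
    Matrix.kroneckerMap_apply, Matrix.single_apply, Matrix.one_apply, Prod.mk.injEq, and_true,
    and_self]
  congr 1
  refine Finset.sum_congr rfl fun j _ => ?_
  split_ifs <;> simp

/-- Extremality of rank-one operators: if positive rank-one operators sum to `|φ⟩⟨φ|`, each is a
multiple of it. The register is trivial here, so it plays no role. -/
theorem exists_smul_of_sum_pureOp {φ : PureState k} (hφ : φ.amp ≠ 0) {ι : Type} [Fintype ι]
    (v : ι → Idx φ.dim → ℂ) (x : ι → Unit)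
    (h : ∑ a, pureOp (A := φ.space) (v a) (x a) = φ.density) :
    ∃ q : ι → ℂ, ∑ a, ‖q a‖ ^ 2 = 1 ∧ ∀ a, v a = q a • φ.amp := by
  obtain ⟨y, hy⟩ := Function.ne_iff.1 hφ
  have hy : φ.amp y ≠ 0 := hy
  have key : ∀ p r, ∑ a, v a p * star (v a r) = φ.amp p * star (φ.amp r) := by
    intro p r
    have := congrFun (congrFun h (p, ())) (r, ())
    rw [Matrix.sum_apply] at this
    exact (Finset.sum_congr rfl fun a _ =>
      (pureOp_space_apply φ (v a) (x a) (p, ()) (r, ())).symm).trans this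
  -- Proportionality means that all these minors vanish. Summed over `a`, their squared moduli
  -- expand into entries of the known operator `|φ⟩⟨φ|` and cancel.
  have prop : ∀ p a, v a p * φ.amp y - v a y * φ.amp p = 0 := by
    intro p
    have h1 : ∑ a, ((‖v a p * φ.amp y - v a y * φ.amp p‖ ^ 2 : ℝ) : ℂ) = 0 := by
      have e : ∀ a, ((‖v a p * φ.amp y - v a y * φ.amp p‖ ^ 2 : ℝ) : ℂ)
          = (v a p * star (v a p)) * (φ.amp y * star (φ.amp y))
          - (v a p * star (v a y)) * (φ.amp y * star (φ.amp p))
          - (v a y * star (v a p)) * (φ.amp p * star (φ.amp y))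
          + (v a y * star (v a y)) * (φ.amp p * star (φ.amp p)) := by
        intro a
        push_cast
        rw [← Complex.mul_conj', map_sub, map_mul, map_mul]
        simp only [RCLike.star_def]
        ring
      simp only [e, Finset.sum_add_distrib, Finset.sum_sub_distrib, ← Finset.sum_mul, key]
      ring
    rw [← Complex.ofReal_sum, Complex.ofReal_eq_zero,
      Finset.sum_eq_zero_iff_of_nonneg (fun _ _ => by positivity)] at h1
    intro a
    simpa using h1 a (Finset.mem_univ a)
  refine ⟨fun a => v a y / φ.amp y, ?_, fun a => ?_⟩
  · have h1 : ∑ a, ‖v a y‖ ^ 2 = ‖φ.amp y‖ ^ 2 := by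
      have := key y y
      simp only [RCLike.star_def, Complex.mul_conj'] at this
      exact_mod_cast this
    have h2 : ‖φ.amp y‖ ^ 2 ≠ 0 := by simpa using hy
    simp only [norm_div, div_pow, ← Finset.sum_div, h1, div_self h2]
  · ext p
    have := sub_eq_zero.1 (prop p a)
    simp only [Pi.smul_apply, smul_eq_mul]
    field_simp
    exact this

/-- Whenever the channel `Ψ` maps an ensemble of pure states to `|φ⟩⟨φ|`, the members of the
ensemble convert to multiples of `φ`. -/
def Purifies (φ : PureState k) {B : StateSpace k} (Ψ : B.Op → φ.space.Op) : Prop :=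
  ∀ (ι : Type) [Fintype ι] (v : ι → Idx B.dim → ℂ) (x : ι → B.Reg),
    Ψ (∑ a, pureOp (v a) (x a)) = φ.density →
    ∃ q : ι → ℂ, ∑ a, ‖q a‖ ^ 2 = 1 ∧ ∀ a, PConv (v a) (q a • φ.amp)

/-- A step `Λ` splits member `a` into branches `(a, j)` with final amplitudes `q (a, j)`. Member `a`
then gets the amplitude `s a`, the `ℓ²` norm over `j`, and its branches get the conditional
amplitudes `q (a, j) / s a`. -/
theorem Purifies.comp_step {φ : PureState k} {A B : StateSpace k} {Ψ : B.Op → φ.space.Op}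
    (hΨ : Purifies φ Ψ) (Λ : OneStep A B) : Purifies φ (fun ρ => Ψ (Λ.apply ρ)) := by
  intro ι _ v x h
  let K : ι → Λ.J → Matrix (Fin (B.dim Λ.party)) (Fin (A.dim Λ.party)) ℂ := fun a j =>
    if Λ.f j = x a then Λ.kraus j else 0
  obtain ⟨q, hq, hconv⟩ := hΨ (ι × Λ.J)
    (fun p => actAt (d := A.dim) (e := B.dim) Λ.party (K p.1 p.2) *ᵥ v p.1)
    (fun p => Λ.g p.2) (by
      rw [← h]
      simp only [apply_sum, Fintype.sum_prod_type, apply_pureOp, K])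
  let s : ι → ℝ := fun a => Real.sqrt (∑ j, ‖q (a, j)‖ ^ 2)
  have hs : ∀ a, s a ^ 2 = ∑ j, ‖q (a, j)‖ ^ 2 := fun a =>
    Real.sq_sqrt (Finset.sum_nonneg fun _ _ => by positivity)
  refine ⟨fun a => (s a : ℂ), ?_, fun a => ?_⟩
  · simp only [Complex.norm_real, Real.norm_eq_abs, sq_abs, hs]
    rw [← hq, Fintype.sum_prod_type]
  · by_cases h0 : s a = 0
    -- Conditional amplitudes are undefined here, but the target is zero and every vector converts
    -- to zero.
    · simp only [h0, Complex.ofReal_zero, zero_smul]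
      exact PConv.zero Λ.party _
    · have hs0 : (s a : ℂ) ≠ 0 := by exact_mod_cast h0
      refine PConv.step Λ.party Λ.J (fun j => Function.update
        (fun l => castMat (B.dim l) (A.dim l)) Λ.party (K a j)) (fun j => q (a, j) / s a)
        ?_ (fun j l hl => ?_) ?_ fun j => ?_
      · simp only [norm_div, div_pow, ← Finset.sum_div, ← hs, Complex.norm_real, Real.norm_eq_abs,
          sq_abs]
        exact div_self (pow_ne_zero 2 h0)
      · rw [Function.update_of_ne hl]
        exact isContr_of_isometry (castMat_isometry (Λ.same l hl).ge)
      · simp only [Function.update_self]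
        exact isKraus_fiber Λ (x a)
      · rw [smul_smul, div_mul_cancel₀ _ hs0, ← actAt_eq_tensorOp]
        exact hconv (a, j)

/-- Channels are peeled off from the last step backwards, since only the final ensemble is known to
be proportional to `φ`. -/
theorem IsLOCC.purifies_comp {φ : PureState k} {A B : StateSpace k} {Φ : A.Op → B.Op}
    (hΦ : IsLOCC Φ) {Ψ : B.Op → φ.space.Op} (hΨ : Purifies φ Ψ) :
    Purifies φ (fun ρ => Ψ (Φ ρ)) := by
  induction hΦ with
  | refl => exact hΨ
  | step Φ Λ _ ih => exact ih (hΨ.comp_step Λ)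

theorem Converts.pconv {ψ φ : PureState k} (i : Fin k) (h : Converts ψ φ) :
    PConv ψ.amp φ.amp := by
  by_cases h0 : φ.amp = 0
  · rw [h0]
    exact PConv.zero i _
  obtain ⟨Φ, hΦ, heq⟩ := h
  have hid : Purifies φ (B := φ.space) (fun ρ => ρ) := by
    intro ι _ v x h
    obtain ⟨q, hq, hv⟩ := exists_smul_of_sum_pureOp h0 v x h
    refine ⟨q, hq, fun a => ?_⟩
    rw [hv a]
    exact PConv.refl _
  obtain ⟨q, hq, hconv⟩ := hΦ.purifies_comp hid Unit (fun _ => ψ.amp) (fun _ => ()) (by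
    rw [← heq, density_eq]
    simp)
  refine PConv.of_phase i (q := q ()) ?_ (hconv ())
  rw [Fintype.sum_unique] at hq
  exact (pow_eq_one_iff_of_nonneg (norm_nonneg _) two_ne_zero).1 hq

end Ensemble

/-! ### Realizing conversion trees by LOCC channels -/

theorem posSemidef_one_sub_mul_conjTranspose {n m : Type*} [Fintype n] [Fintype m] [DecidableEq n]
    [DecidableEq m] {V : Matrix m n ℂ} (hV : Vᴴ * V = 1) : (1 - V * Vᴴ).PosSemidef := by
  have h := Matrix.posSemidef_conjTranspose_mul_self (1 - V * Vᴴ)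
  have e : V * Vᴴ * (V * Vᴴ) = V * Vᴴ := by
    rw [Matrix.mul_assoc, ← Matrix.mul_assoc Vᴴ, hV, Matrix.one_mul]
  rwa [Matrix.conjTranspose_sub, Matrix.conjTranspose_one, Matrix.conjTranspose_mul,
    Matrix.conjTranspose_conjTranspose, Matrix.sub_mul, Matrix.one_mul, Matrix.mul_sub, e,
    Matrix.mul_one, sub_self, sub_zero] at h

theorem isContr_of_coisometry {m n : Type*} [Fintype m] [Fintype n] [DecidableEq n]
    [DecidableEq m] {A : Matrix m n ℂ} (hA : A * Aᴴ = 1) : IsContr A := by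
  simpa [IsContr] using posSemidef_one_sub_mul_conjTranspose (V := Aᴴ) (by simpa using hA)

/-- The new defect is the conjugate of the old one by `V` plus `1 - V * Vᴴ`, the projection off the
range of `V`. -/
theorem isKraus_conj {J m n m' n' : Type*} [Fintype J] [Fintype m] [Fintype n] [Fintype m']
    [Fintype n'] [DecidableEq m] [DecidableEq n] [DecidableEq n'] {A : J → Matrix m n ℂ}
    (hA : IsKraus A) {U : Matrix m' m ℂ} {V : Matrix n' n ℂ} (hU : Uᴴ * U = 1)
    (hV : Vᴴ * V = 1) : IsKraus fun j => U * A j * Vᴴ := by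
  have h1 := hA.mul_mul_conjTranspose_same V
  have h2 := posSemidef_one_sub_mul_conjTranspose hV
  have e3 : ∀ j, (U * A j * Vᴴ)ᴴ * (U * A j * Vᴴ) = V * ((A j)ᴴ * A j) * Vᴴ := by
    intro j
    have : Uᴴ * (U * (A j * Vᴴ)) = A j * Vᴴ := by rw [← Matrix.mul_assoc, hU, Matrix.one_mul]
    simp only [Matrix.conjTranspose_mul, Matrix.conjTranspose_conjTranspose, Matrix.mul_assoc, this]
  have h3 := h2.add h1
  rw [IsKraus]
  convert h3 using 1
  simp only [e3, Matrix.mul_sub, Matrix.sub_mul, Matrix.mul_one, ← Matrix.sum_mul,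
    ← Matrix.mul_sum]
  abel

theorem isContr_conj {m n m' n' : Type*} [Fintype m] [Fintype n] [Fintype m']
    [Fintype n'] [DecidableEq m] [DecidableEq n] [DecidableEq n'] {A : Matrix m n ℂ}
    (hA : IsContr A) {U : Matrix m' m ℂ} {V : Matrix n' n ℂ} (hU : Uᴴ * U = 1)
    (hV : Vᴴ * V = 1) : IsContr (U * A * Vᴴ) :=
  isContr_of_isKraus (isKraus_conj (isKraus_unit hA) hU hV)

/-- Converse of `isKraus_fiber`: the operator is block diagonal in the register, with the defect of
the fibre over `x` as block `x`. -/
theorem posSemidef_one_sub_sum_kronecker {J X m n : Type*} [Fintype J] [Fintype X] [DecidableEq X]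
    [Fintype m] [Fintype n] [DecidableEq n] (f : J → X) (K : J → Matrix m n ℂ)
    (hK : ∀ x, IsKraus fun j => if f j = x then K j else 0) :
    (1 - ∑ j, ((K j)ᴴ * K j) ⊗ₖ Matrix.single (f j) (f j) (1 : ℂ)).PosSemidef := by
  have hs : ∀ x : X, (Matrix.single x x (1 : ℂ)).PosSemidef := by
    intro x
    rw [← Matrix.diagonal_single]
    refine Matrix.PosSemidef.diagonal fun y => ?_
    by_cases hy : y = x
    · subst hy; simp
    · simp [hy]
  have h : (∑ x, (1 - ∑ j, (if f j = x then K j else 0)ᴴ * (if f j = x then K j else 0))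
      ⊗ₖ Matrix.single x x (1 : ℂ)).PosSemidef :=
    Matrix.posSemidef_sum Finset.univ fun x _ => Matrix.PosSemidef.kronecker (hK x) (hs x)
  refine (congrArg Matrix.PosSemidef ?_).mpr h
  ext ⟨a, x⟩ ⟨b, y⟩
  simp only [Matrix.sub_apply, Matrix.sum_apply, Matrix.kroneckerMap_apply, Matrix.single_apply,
    mul_ite, mul_one, mul_zero, Matrix.one_apply, Prod.mk.injEq]
  by_cases hxy : x = y
  · subst hxy
    rw [Finset.sum_eq_single x]
    · simp only [and_self, and_true, if_true]
      congr 1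
      refine Finset.sum_congr rfl fun j _ => ?_
      split_ifs <;> simp
    · intro z _ hz
      simp [hz]
    · simp
  · rw [if_neg (by simp [hxy]), zero_sub, Finset.sum_eq_zero, Finset.sum_eq_zero, neg_zero]
    · intro z _
      rw [if_neg]
      rintro ⟨rfl, rfl⟩
      exact hxy rfl
    · intro j _
      rw [if_neg]
      rintro ⟨rfl, rfl⟩
      exact hxy rfl

section Reach

variable {k N : ℕ}

/-- The state space with all local dimensions `N` and register `X`. -/
abbrev uniformSpace (k N : ℕ) (X : Type) [Fintype X] [DecidableEq X] : StateSpace k :=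
  ⟨fun _ => N, X⟩

/-- The ensemble `∑ x, |v x⟩⟨v x| ⊗ |x⟩⟨x|`. -/
def ensemble {X : Type} [Fintype X] [DecidableEq X] (v : X → Idx (fun _ : Fin k => N) → ℂ) :
    (uniformSpace k N X).Op :=
  ∑ x, pureOp (A := uniformSpace k N X) (v x) x

/-- Some LOCC channel maps one ensemble to the other. -/
def Reach {X Y : Type} [Fintype X] [DecidableEq X] [Fintype Y] [DecidableEq Y]
    (v : X → Idx (fun _ : Fin k => N) → ℂ) (w : Y → Idx (fun _ : Fin k => N) → ℂ) : Prop :=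
  ∃ Φ : (uniformSpace k N X).Op → (uniformSpace k N Y).Op,
    IsLOCC Φ ∧ Φ (ensemble v) = ensemble w

variable {X Y Z : Type} [Fintype X] [DecidableEq X] [Fintype Y] [DecidableEq Y] [Fintype Z]
  [DecidableEq Z]

theorem Reach.refl (v : X → Idx (fun _ : Fin k => N) → ℂ) : Reach v v := ⟨_, IsLOCC.refl _, rfl⟩

theorem Reach.trans {u : X → Idx (fun _ : Fin k => N) → ℂ} {v : Y → Idx (fun _ : Fin k => N) → ℂ}
    {w : Z → Idx (fun _ : Fin k => N) → ℂ} (h : Reach u v) (h' : Reach v w) : Reach u w := by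
  obtain ⟨Φ, h1, h2⟩ := h
  obtain ⟨Ψ, g1, g2⟩ := h'
  exact ⟨_, g1.comp h1, by rw [h2, g2]⟩

theorem Reach.step (i : Fin k) {J : Type} [Fintype J] (f : J → X) (g : J → Y)
    (K : J → Matrix (Fin N) (Fin N) ℂ) (hK : ∀ x, IsKraus fun j => if f j = x then K j else 0)
    {v : X → Idx (fun _ : Fin k => N) → ℂ} {w : Y → Idx (fun _ : Fin k => N) → ℂ}
    (h : ∑ j, pureOp (A := uniformSpace k N Y)
      (tensorOp (d := fun _ : Fin k => N) (Function.update (fun _ => 1) i (K j)) *ᵥ v (f j)) (g j)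
        = ensemble w) : Reach v w := by
  let Λ : OneStep (uniformSpace k N X) (uniformSpace k N Y) :=
    { party := i
      same := fun _ _ => rfl
      J := J
      f := f
      g := g
      kraus := K
      kraus_le := posSemidef_one_sub_sum_kronecker f K hK }
  refine ⟨_, IsLOCC.step _ Λ (IsLOCC.refl _), ?_⟩
  rw [← h, ensemble, apply_sum]
  simp only [apply_pureOp]
  rw [Finset.sum_comm]
  refine Finset.sum_congr rfl fun j _ => ?_
  rw [Finset.sum_eq_single (f j)]
  · rw [if_pos rfl, actAt_eq_tensorOp]
    simp only [castMat_self]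
    rfl
  · intro x _ hx
    rw [if_neg (Ne.symm hx), actAt_eq_tensorOp, tensorOp_eq_zero _ i (Function.update_self _ _ _),
      Matrix.zero_mulVec, pureOp_zero]
  · simp

theorem Reach.contr_single (i : Fin k) (B : X → Matrix (Fin N) (Fin N) ℂ)
    (hB : ∀ x, IsContr (B x)) (v : X → Idx (fun _ : Fin k => N) → ℂ) :
    Reach v fun x => tensorOp (d := fun _ : Fin k => N) (Function.update (fun _ => 1) i (B x))
      *ᵥ v x := by
  refine Reach.step i id id B (fun x => ?_) rfl
  rw [IsKraus, Finset.sum_eq_single x]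
  · simpa [IsContr] using hB x
  · intro y _ hy
    simp [hy]
  · simp

theorem Reach.contr (B : X → Fin k → Matrix (Fin N) (Fin N) ℂ)
    (hB : ∀ x l, IsContr (B x l)) (v : X → Idx (fun _ : Fin k => N) → ℂ) :
    Reach v fun x => tensorOp (d := fun _ : Fin k => N) (B x) *ᵥ v x := by
  have h : ∀ s : Finset (Fin k), Reach v fun x =>
      tensorOp (d := fun _ : Fin k => N) (e := fun _ : Fin k => N)
        (fun l => if l ∈ s then B x l else 1) *ᵥ v x := by
    intro s
    induction s using Finset.induction_on with
    | empty =>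
      simp only [Finset.notMem_empty, if_false, tensorOp_one, Matrix.one_mulVec]
      exact Reach.refl v
    | insert i s hi ih =>
      have := ih.trans (Reach.contr_single i (fun x => B x i) (fun x => hB x i) _)
      simp only [Matrix.mulVec_mulVec, tensorOp_mul] at this
      have e : ∀ x, (fun l => if l ∈ insert i s then B x l else 1)
          = fun l => Function.update (fun _ => 1) i (B x i) l * if l ∈ s then B x l else 1 := by
        intro x
        funext l
        by_cases hl : l = i
        · subst hl; simp [hi]
        · simp [hl]
      simpa only [e] using this
  simpa using h Finset.univ

/-- The embedding of a vector into uniform local dimensions `N`. -/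
def pad (N : ℕ) {d : Fin k → ℕ} (v : Idx d → ℂ) : Idx (fun _ : Fin k => N) → ℂ :=
  tensorOp (fun l => castMat N (d l)) *ᵥ v

/-- The outcome is recorded in an enlarged register `X ⊕ J`, the others act conditionally on it,
each branch is finished by `next`, and the outcome is then forgotten. Since `next` changes a single
entry of an arbitrary ensemble, branches can be treated one after another. -/
theorem Reach.measure (i : Fin k) {J : Type} [Fintype J] [DecidableEq J]
    (A : J → Fin k → Matrix (Fin N) (Fin N) ℂ) (q : J → ℂ) (hq : ∑ j, ‖q j‖ ^ 2 = 1)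
    (hA : ∀ j l, l ≠ i → IsContr (A j l)) (hi : IsKraus fun j => A j i)
    (v : X → Idx (fun _ : Fin k => N) → ℂ) (x : X) (w : Idx (fun _ : Fin k => N) → ℂ)
    (next : ∀ (u : X ⊕ J → Idx (fun _ : Fin k => N) → ℂ) (j : J),
      u (Sum.inr j) = tensorOp (d := fun _ : Fin k => N) (A j) *ᵥ v x →
      Reach u (Function.update u (Sum.inr j) (q j • w))) :
    Reach v (Function.update v x w) := by
  let v₀ : X → Idx (fun _ : Fin k => N) → ℂ := fun y => if y = x then 0 else v y
  have step1 : Reach v (Sum.elim v₀ fun j : J => tensorOp (d := fun _ : Fin k => N)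
      (Function.update (fun _ => 1) i (A j i)) *ᵥ v x) := by
    -- Entries other than `x` are kept by the identity. Entry `x` gets the zero operator in
    -- `Sum.inl`, so only the measurement operators `A j i` contribute to its fibre.
    refine Reach.step i (J := X ⊕ J) (Sum.elim id fun _ => x) id
      (Sum.elim (fun y => if y = x then 0 else 1) fun j => A j i) (fun y => ?_) ?_
    · by_cases hy : y = x
      · subst hy
        rw [IsKraus, Fintype.sum_sum_type, Finset.sum_eq_zero, zero_add]
        · simpa [IsKraus] using hi
        · intro z _
          simp only [Sum.elim_inl, id]
          split_ifs <;> simp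
      · rw [IsKraus, Fintype.sum_sum_type, Finset.sum_eq_single y]
        · simpa [hy, Ne.symm hy] using Matrix.PosSemidef.zero
        · intro z _ hz
          simp [hz]
        · simp
    · rw [ensemble]
      refine Finset.sum_congr rfl fun z _ => ?_
      rcases z with y | j
      · by_cases hy : y = x
        · simp only [Sum.elim_inl, if_pos hy, v₀, id]
          rw [tensorOp_eq_zero _ i (Function.update_self _ _ _), Matrix.zero_mulVec]
        · simp only [Sum.elim_inl, if_neg hy, v₀, id]
          rw [Function.update_eq_self i, tensorOp_one, Matrix.one_mulVec]
      · rfl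
  have step2 : Reach v (Sum.elim v₀ fun j : J => tensorOp (d := fun _ : Fin k => N) (A j)
      *ᵥ v x) := by
    have := step1.trans (Reach.contr (Sum.elim (fun _ _ => 1)
      fun j l => if l = i then 1 else A j l) (fun z l => ?_) _)
    · convert this using 1
      funext z
      rcases z with y | j
      · simp only [Sum.elim_inl, tensorOp_one, Matrix.one_mulVec]
      · simp only [Sum.elim_inr, Matrix.mulVec_mulVec, tensorOp_mul]
        congr 2
        funext l
        by_cases hl : l = i
        · subst hl; simp
        · simp [hl]
    · rcases z with y | j
      · exact isContr_one
      · simp only [Sum.elim_inr]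
        split_ifs with hl
        · exact isContr_one
        · exact hA j l hl
  have step3 : ∀ s : Finset J, Reach v (Sum.elim v₀ fun j : J =>
      if j ∈ s then q j • w else tensorOp (d := fun _ : Fin k => N) (A j) *ᵥ v x) := by
    intro s
    induction s using Finset.induction_on with
    | empty => simpa using step2
    | insert j s hj ih =>
      have := ih.trans (next _ j (by simp [hj]))
      convert this using 1
      funext z
      rcases z with y | j'
      · simp
      · by_cases h : j' = j
        · subst h; simp
        · simp [h]
  have step4 := step3 Finset.univ
  simp only [Finset.mem_univ, if_true] at step4
  -- Merging all labels `Sum.inr j` into `x` adds up `‖q j‖ ^ 2` copies of `|w⟩⟨w|`, which is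
  -- exactly one by `hq`.
  refine step4.trans (Reach.step i (J := X ⊕ J) id (Sum.elim id fun _ => x) (fun _ => 1)
    (fun z => ?_) ?_)
  · rw [IsKraus, Finset.sum_eq_single z]
    · simpa using Matrix.PosSemidef.zero
    · intro y _ hy
      simp [hy]
    · simp
  · simp only [Function.update_eq_self, tensorOp_one, Matrix.one_mulVec, id]
    rw [Fintype.sum_sum_type]
    simp only [Sum.elim_inl, Sum.elim_inr, pureOp_smul, id]
    rw [← Finset.sum_smul, ← Complex.ofReal_sum, hq, Complex.ofReal_one, one_smul, ensemble]
    have e : ∀ y, pureOp (A := uniformSpace k N X) (Function.update v x w y) y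
        = pureOp (A := uniformSpace k N X) (v₀ y) y
          + if y = x then pureOp (A := uniformSpace k N X) w x else 0 := by
      intro y
      by_cases hy : y = x
      · subst hy
        simp only [Function.update_self, v₀, if_pos]
        rw [show (0 : Idx (fun _ : Fin k => N) → ℂ) = (0 : Idx (uniformSpace k N X).dim → ℂ)
          from rfl, pureOp_zero, zero_add]
      · simp only [Function.update_of_ne hy, v₀, if_neg hy, add_zero]
    simp only [e, Finset.sum_add_distrib, Finset.sum_ite_eq', Finset.mem_univ, if_true]

/-- Padding to one common dimension `N` lets branches of the tree with different intermediate spaces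
coexist in one ensemble. The bystanders in `u` are arbitrary so that the induction applies inside
`Reach.measure`. -/
theorem PConv.exists_reach {d e : Fin k → ℕ} {v : Idx d → ℂ} {w : Idx e → ℂ} (h : PConv v w) :
    ∃ N₀, ∀ N, N₀ ≤ N → ∀ (X : Type) [Fintype X] [DecidableEq X]
      (u : X → Idx (fun _ : Fin k => N) → ℂ) (x : X), u x = pad N v →
      Reach u (Function.update u x (pad N w)) := by
  classical
  induction h with
  | refl v =>
    refine ⟨0, fun N _ X _ _ u x hx => ?_⟩
    rw [← hx, Function.update_eq_self]
    exact Reach.refl u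
  | @step c d e v w i J _ A q hq hA hi next ih =>
    choose M hM using ih
    -- This bound exceeds the requirement of every branch and all local dimensions of the step, so
    -- the paddings are isometries.
    refine ⟨∑ j, M j + (∑ l, c l + ∑ l, d l), fun N hN X _ _ u x hx => ?_⟩
    have hc : ∀ l, (castMat N (c l))ᴴ * castMat N (c l) = 1 := by
      intro l
      have := Finset.single_le_sum (f := c) (fun _ _ => Nat.zero_le _) (Finset.mem_univ l)
      exact castMat_isometry (by omega)
    have hd : ∀ l, (castMat N (d l))ᴴ * castMat N (d l) = 1 := by
      intro l
      have := Finset.single_le_sum (f := d) (fun _ _ => Nat.zero_le _) (Finset.mem_univ l)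
      exact castMat_isometry (by omega)
    refine Reach.measure i (fun j l => castMat N (c l) * A j l * (castMat N (d l))ᴴ) q hq
      (fun j l hl => isContr_conj (hA j l hl) (hc l) (hd l)) (isKraus_conj hi (hc i) (hd i))
      u x (pad N w) fun u' j hu' => ?_
    have h1 := hM j N (by
      have := Finset.single_le_sum (f := M) (fun _ _ => Nat.zero_le _) (Finset.mem_univ j)
      omega) (X ⊕ J) u' (Sum.inr j) (by
        rw [hu', hx, pad, pad, Matrix.mulVec_mulVec, Matrix.mulVec_mulVec, tensorOp_mul,
          tensorOp_mul]
        simp only [Matrix.mul_assoc, hd, Matrix.mul_one])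
    rwa [pad, Matrix.mulVec_smul] at h1

theorem converts_of_pconv {ψ φ : PureState k} (h : PConv ψ.amp φ.amp) : Converts ψ φ := by
  obtain ⟨N₀, hN₀⟩ := h.exists_reach
  let N := N₀ + (∑ l, ψ.dim l + ∑ l, φ.dim l)
  have hψ : LUEquiv ψ ⟨fun _ => N, pad N ψ.amp⟩ :=
    LUVec.of_isometry (fun l => castMat N (ψ.dim l)) (fun l => castMat_isometry (by
      have := Finset.single_le_sum (f := ψ.dim) (fun _ _ => Nat.zero_le _) (Finset.mem_univ l)
      omega)) rfl
  have hφ : LUEquiv φ ⟨fun _ => N, pad N φ.amp⟩ :=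
    LUVec.of_isometry (fun l => castMat N (φ.dim l)) (fun l => castMat_isometry (by
      have := Finset.single_le_sum (f := φ.dim) (fun _ _ => Nat.zero_le _) (Finset.mem_univ l)
      omega)) rfl
  refine hψ.converts.trans (Converts.trans ?_ (LUEquiv.converts (LUVec.symm hφ)))
  obtain ⟨Φ, h1, h2⟩ := hN₀ N (by omega) Unit (fun _ => pad N ψ.amp) () rfl
  refine ⟨Φ, h1, ?_⟩
  rw [density_eq, density_eq]
  rw [ensemble, ensemble, Fintype.sum_unique, Fintype.sum_unique, Function.update_apply,
    if_pos rfl] at h2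
  exact h2

theorem converts_iff_pconv (i : Fin k) {ψ φ : PureState k} :
    Converts ψ φ ↔ PConv ψ.amp φ.amp :=
  ⟨Converts.pconv i, converts_of_pconv⟩

end Reach

/-! ### The Strassen preorder on local unitary classes -/

theorem normSqVec_mulVec_le {m n : Type*} [Fintype m] [Fintype n] (A : Matrix m n ℂ) (v : n → ℂ) :
    normSqVec (A *ᵥ v) ≤ (∑ y, ∑ x, ‖A y x‖ ^ 2) * normSqVec v := by
  rw [normSqVec, Finset.sum_mul]
  refine Finset.sum_le_sum fun y _ => ?_
  calc ‖(A *ᵥ v) y‖ ^ 2 ≤ (∑ x, ‖A y x‖ * ‖v x‖) ^ 2 := by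
        gcongr
        refine (norm_sum_le _ _).trans (le_of_eq ?_)
        simp only [norm_mul]
    _ ≤ _ := Finset.sum_mul_sq_le_sq_mul_sq _ _ _

section Contr

variable {m n : Type*} [Fintype m] [Fintype n] [DecidableEq n]

theorem isContr_smul {A : Matrix m n ℂ} (hA : IsContr A) {t : ℂ} (ht : ‖t‖ ≤ 1) :
    IsContr (t • A) := by
  let s : ℝ := Real.sqrt (1 - ‖t‖ ^ 2)
  have hs : s ^ 2 = 1 - ‖t‖ ^ 2 :=
    Real.sq_sqrt (sub_nonneg.2 (pow_le_one₀ (norm_nonneg _) ht))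
  have e : ∀ c : ℂ, (c • A)ᴴ * (c • A) = ((‖c‖ ^ 2 : ℝ) : ℂ) • (Aᴴ * A) := by
    intro c
    rw [Matrix.conjTranspose_smul, Matrix.smul_mul, Matrix.mul_smul, smul_smul, RCLike.star_def,
      Complex.conj_mul']
    push_cast
    rfl
  -- The defect of `t • A` is that of `A` plus `(1 - ‖t‖ ^ 2)` times `Aᴴ * A`, and `s` is the square
  -- root of that coefficient.
  have h := Matrix.PosSemidef.add hA (Matrix.posSemidef_conjTranspose_mul_self ((s : ℂ) • A))
  rw [e, Complex.norm_real, Real.norm_eq_abs, sq_abs, hs] at h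
  rw [IsContr, e]
  convert h using 1
  rw [Complex.ofReal_sub, sub_smul, Complex.ofReal_one, one_smul]
  abel

theorem exists_isContr_smul (A : Matrix m n ℂ) : ∃ t : ℂ, t ≠ 0 ∧ IsContr (t • A) := by
  let F : ℝ := ∑ y, ∑ x, ‖A y x‖ ^ 2
  have hF : 0 ≤ F := Finset.sum_nonneg fun _ _ => Finset.sum_nonneg fun _ _ => by positivity
  -- The squared operator norm is at most the squared Frobenius norm `F`, and `F ≤ (F + 1) ^ 2`.
  refine ⟨((F + 1)⁻¹ : ℝ), by exact_mod_cast (by positivity : (F + 1)⁻¹ ≠ 0), ?_⟩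
  refine Matrix.PosSemidef.of_dotProduct_mulVec_nonneg ?_ fun v => ?_
  · exact Matrix.isHermitian_one.sub (Matrix.isHermitian_conjTranspose_mul_self _)
  rw [Matrix.sub_mulVec, Matrix.one_mulVec, dotProduct_sub, sub_nonneg, ← Matrix.mulVec_mulVec,
    Matrix.dotProduct_mulVec, ← Matrix.star_mulVec, ← normSqVec_eq, ← normSqVec_eq,
    Matrix.smul_mulVec, normSqVec_smul]
  have h1 := normSqVec_mulVec_le A v
  have h2 : 0 ≤ normSqVec v := Finset.sum_nonneg fun _ _ => by positivity
  have h3 : ‖(((F + 1)⁻¹ : ℝ) : ℂ)‖ ^ 2 * (F * normSqVec v) ≤ normSqVec v := by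
    rw [Complex.norm_real, Real.norm_eq_abs, sq_abs, ← mul_assoc]
    refine mul_le_of_le_one_left h2 ?_
    rw [inv_pow, inv_mul_le_iff₀ (by positivity)]
    nlinarith
  have h4 : ‖(((F + 1)⁻¹ : ℝ) : ℂ)‖ ^ 2 * normSqVec (A *ᵥ v) ≤ normSqVec v :=
    (mul_le_mul_of_nonneg_left h1 (by positivity)).trans h3
  exact_mod_cast h4

end Contr

section Order

variable {k : ℕ}

theorem cls_le_iff (i : Fin k) {φ ψ : PureState k} : cls φ ≤ cls ψ ↔ PConv ψ.amp φ.amp :=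
  converts_iff_pconv i

theorem cls_le_of_isContr (i : Fin k) {d e : Fin k → ℕ}
    (A : ∀ l, Matrix (Fin (e l)) (Fin (d l)) ℂ) (hA : ∀ l, IsContr (A l)) (v : Idx d → ℂ) :
    cls ⟨e, tensorOp A *ᵥ v⟩ ≤ cls ⟨d, v⟩ :=
  (cls_le_iff i).2 (PConv.of_isContr i A hA v)

theorem add_le_add_right_of_le (i : Fin k) (a b c : LUClass k) (h : a ≤ b) : a + c ≤ b + c := by
  obtain ⟨φ⟩ := a
  obtain ⟨ψ⟩ := b
  obtain ⟨χ⟩ := c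
  exact (cls_le_iff (φ := φ.dirSum χ) (ψ := ψ.dirSum χ) i).2
    (((cls_le_iff (φ := φ) (ψ := ψ) i).1 h).dirSum χ.amp)

theorem mul_le_mul_right_of_le (i : Fin k) (a b c : LUClass k) (h : a ≤ b) : a * c ≤ b * c := by
  obtain ⟨φ⟩ := a
  obtain ⟨ψ⟩ := b
  obtain ⟨χ⟩ := c
  exact (cls_le_iff (φ := φ.tensor χ) (ψ := ψ.tensor χ) i).2
    (((cls_le_iff (φ := φ) (ψ := ψ) i).1 h).tensor χ.amp)

theorem zero_le_cls (i : Fin k) (a : LUClass k) : 0 ≤ a := by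
  obtain ⟨ψ⟩ := a
  exact (cls_le_iff (φ := zeroState k) (ψ := ψ) i).2 (PConv.zero i ψ.amp)

theorem cls_eq_zero {ψ : PureState k} (h : ψ.amp = 0) : cls ψ = 0 :=
  Quotient.sound (⟨fun _ => 0, fun _ => by simp, by rw [h, Matrix.mulVec_zero]; rfl, by
    rw [h]; exact (Matrix.mulVec_zero _).symm⟩ : LUVec ψ.amp (zeroState k).amp)

/-! ### GHZ states as natural numbers -/

theorem tensorOp_mulVec_ghz {e : Fin k → ℕ} {D : ℕ} (A : ∀ l, Matrix (Fin (e l)) (Fin D) ℂ)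
    (x : Idx e) : (tensorOp A *ᵥ (ghz k D).amp) x = ∑ i, ∏ l, A l (x l) i := by
  simp only [Matrix.mulVec, dotProduct, ghz, Finset.mul_sum, mul_ite, mul_one, mul_zero]
  rw [Finset.sum_comm]
  refine Finset.sum_congr rfl fun i _ => ?_
  rw [Finset.sum_ite_eq' Finset.univ (fun _ => i) (fun y => tensorOp A x y)]
  simp [tensorOp]

theorem cls_ghz_succ (k d : ℕ) : cls (ghz k (d + 1)) = cls (ghz k d) + 1 := by
  have h : ∀ x : Idx (fun _ : Fin k => d + 1),
      (ghz k (d + 1)).amp x = dirSumVec (ghz k d).amp (unitState k).amp x := by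
    intro x
    have h1 := tensorOp_mulVec_ghz (k := k) (e := fun _ => d + 1) (fun _ => inclL d 1) x
    have h2 : (tensorOp (fun _ : Fin k => inclR d 1) *ᵥ (unitState k).amp) x
        = if x = fun _ => Fin.last d then 1 else 0 := by
      simp only [Matrix.mulVec, dotProduct, unitState, mul_one, tensorOp, inclR, basisMap,
        Finset.prod_ite_zero]
      rw [Fintype.sum_unique]
      simp [funext_iff, Fin.ext_iff]
    refine Eq.trans ?_ (congrArg₂ (· + ·) h1 h2).symm
    change (∑ i : Fin (d + 1), if x = fun _ => i then (1 : ℂ) else 0) = _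
    rw [Fin.sum_univ_castSucc]
    congr 1
    refine Finset.sum_congr rfl fun i _ => ?_
    simp only [inclL, basisMap, Finset.prod_ite_zero]
    simp [funext_iff, Fin.ext_iff]
  exact congrArg (fun v => cls (⟨fun _ => d + 1, v⟩ : PureState k)) (funext h)

theorem natCast_eq_cls_ghz (hk : 1 ≤ k) (d : ℕ) : (d : LUClass k) = cls (ghz k d) := by
  induction d with
  | zero =>
    rw [Nat.cast_zero]
    refine (cls_eq_zero ?_).symm
    funext x
    exact (x ⟨0, hk⟩).elim0
  | succ d ih => rw [Nat.cast_succ, ih, cls_ghz_succ]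

theorem normSqVec_ghz (hk : 1 ≤ k) (d : ℕ) : normSqVec (ghz k d).amp = d := by
  have inj : Function.Injective fun (i : Fin d) (_ : Fin k) => i :=
    fun a b h => congrFun h ⟨0, hk⟩
  have h : ∑ _i : Fin d, (1 : ℝ) = normSqVec (ghz k d).amp := by
    refine Fintype.sum_of_injective _ inj _ _ (fun x hx => ?_) fun i => ?_
    · have : ∀ i : Fin d, x ≠ fun _ => i := fun i h => hx ⟨i, h.symm⟩
      simp [ghz, this]
    · simp [ghz, inj.eq_iff]
  rw [← h]
  simp

theorem not_natCast_succ_le (hk : 1 ≤ k) (n : ℕ) : ¬ ((n : LUClass k) + 1 ≤ n) := by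
  intro h
  rw [← Nat.cast_succ, natCast_eq_cls_ghz hk, natCast_eq_cls_ghz hk, cls_le_iff ⟨0, hk⟩] at h
  have := h.normSqVec_le
  rw [normSqVec_ghz hk, normSqVec_ghz hk] at this
  push_cast at this
  linarith

/-! ### Multiples of the product state -/

/-- The multiple `c |0 … 0⟩` of the product state. -/
def scalarState (k : ℕ) (c : ℂ) : PureState k := ⟨fun _ => 1, fun _ => c⟩

theorem cls_smul {d : Fin k → ℕ} (c : ℂ) (v : Idx d → ℂ) :
    cls ⟨d, c • v⟩ = cls (scalarState k c) * cls ⟨d, v⟩ := by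
  have h : LUVec (tensorVec (fun _ => c : Idx (fun _ : Fin k => 1) → ℂ) v) (c • v) := by
    refine LUVec.of_equiv (fun j => finProdFinEquiv.symm.trans (Equiv.uniqueProd _ (Fin 1)))
      fun x => ?_
    simp only [tensorVec, Equiv.trans_apply, Equiv.uniqueProd_apply, Pi.smul_apply, smul_eq_mul]
  exact (Quotient.sound h).symm

theorem cls_scalarState_mul (c c' : ℂ) :
    cls (scalarState k (c * c')) = cls (scalarState k c) * cls (scalarState k c') :=
  cls_smul c (fun _ : Idx (fun _ : Fin k => 1) => c')

theorem cls_scalarState_one : cls (scalarState k 1) = 1 := rfl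

theorem cls_scalarState_pow (c : ℂ) (n : ℕ) :
    cls (scalarState k (c ^ n)) = cls (scalarState k c) ^ n := by
  induction n with
  | zero => rw [pow_zero, pow_zero, cls_scalarState_one]
  | succ n ih => rw [pow_succ, pow_succ, cls_scalarState_mul, ih]

theorem cls_scalarState_le_one (i : Fin k) {c : ℂ} (hc : ‖c‖ ≤ 1) :
    cls (scalarState k c) ≤ 1 := by
  have h := cls_le_of_isContr i (d := fun _ => 1) (e := fun _ => 1)
    (Function.update (fun _ => 1) i (c • 1)) (fun l => by
      by_cases hl : l = i
      · subst hl
        rw [Function.update_self]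
        exact isContr_smul isContr_one hc
      · rw [Function.update_of_ne hl]
        exact isContr_one) (fun _ => 1)
  have e : (tensorOp (d := fun _ => 1) (e := fun _ => 1)
      (Function.update (fun _ => 1) i (c • 1)) *ᵥ
      (fun _ => 1 : Idx (fun _ : Fin k => 1) → ℂ)) = fun _ => c := by
    funext x
    rw [tensorOp_single]
    simp [Matrix.one_apply, eq_iff_true_of_subsingleton]
  rw [e] at h
  exact h

/-! ### Concentrating the norm of `GHZ_2` in a product state -/

theorem tensorOp_mulVec_single {d e : Fin k → ℕ} (A : ∀ l, Matrix (Fin (e l)) (Fin (d l)) ℂ)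
    (a : Idx d) (b : Idx e) (t : Fin k → ℂ)
    (h : ∀ l x, A l x (a l) = t l * if x = b l then 1 else 0) :
    tensorOp A *ᵥ Pi.single a 1 = (∏ l, t l) • Pi.single b 1 := by
  rw [Matrix.mulVec_single_one]
  funext x
  simp only [Matrix.col_apply, tensorOp, h, Finset.prod_mul_distrib, Finset.prod_ite_zero,
    Pi.smul_apply, smul_eq_mul, Pi.single_apply]
  simp [funext_iff]

/-- The vector `|0 … 0⟩ + |x⟩` with `x` the indicator of `s`: a GHZ state shared by the parties
in `s`. -/
def partialGHZ (s : Finset (Fin k)) : Idx (fun _ : Fin k => 2) → ℂ :=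
  Pi.single (fun _ => 0) 1 + Pi.single (fun l => if l ∈ s then 1 else 0) 1

theorem partialGHZ_univ : partialGHZ (Finset.univ : Finset (Fin k)) = (ghz k 2).amp := by
  funext x
  simp only [partialGHZ, ghz, Pi.add_apply, Pi.single_apply, Fin.sum_univ_two, Finset.mem_univ,
    if_true]

/-- The Kraus operator `|0⟩(⟨0| + σ ⟨1|) / √2`. -/
def hadamardKraus (σ : ℂ) : Matrix (Fin 2) (Fin 2) ℂ :=
  !![((Real.sqrt 2)⁻¹ : ℝ), σ * ((Real.sqrt 2)⁻¹ : ℝ); 0, 0]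

theorem ofReal_sqrt_two_inv_mul_self :
    (((Real.sqrt 2)⁻¹ : ℝ) : ℂ) * (((Real.sqrt 2)⁻¹ : ℝ) : ℂ) = 2⁻¹ := by
  rw [← Complex.ofReal_mul, ← mul_inv, Real.mul_self_sqrt (by norm_num)]
  push_cast
  rfl

theorem isKraus_hadamard :
    IsKraus fun b : Bool => hadamardKraus (if b then 1 else -1) := by
  have h : ∑ b : Bool, (hadamardKraus (if b then 1 else -1))ᴴ
      * hadamardKraus (if b then 1 else -1) = 1 := by
    rw [Fintype.sum_bool]
    ext x y
    have h2 := ofReal_sqrt_two_inv_mul_self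
    fin_cases x <;> fin_cases y <;>
      simp [hadamardKraus, Matrix.mul_apply, Matrix.conjTranspose_apply, Fin.sum_univ_two] at h2 ⊢
      <;> rw [h2] <;> norm_num
  rw [IsKraus, h, sub_self]
  exact Matrix.PosSemidef.zero

/-- Party `i` measures in the basis `|±⟩`. The outcome leaves a relative sign `σ` between the two
terms, which party `i₀` undoes with `diag(1, σ)`; both outcomes have amplitude `1 / √2`, so no norm
is lost. -/
theorem partialGHZ_insert_pconv {s : Finset (Fin k)} {i₀ i : Fin k} (h₀ : i₀ ∈ s) (hi : i ∉ s) :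
    PConv (partialGHZ (insert i s)) (partialGHZ s) := by
  have hne : i₀ ≠ i := fun h => hi (h ▸ h₀)
  let σ : Bool → ℂ := fun b => if b then 1 else -1
  have hσ : ∀ b, σ b * σ b = 1 := by
    intro b
    cases b <;> simp [σ]
  let Z : Bool → Matrix (Fin 2) (Fin 2) ℂ := fun b => !![1, 0; 0, σ b]
  let r : ℂ := ((Real.sqrt 2)⁻¹ : ℝ)
  have hZ : ∀ b, IsContr (Z b) := by
    intro b
    refine isContr_of_isometry ?_
    ext x y
    cases b <;> fin_cases x <;> fin_cases y <;> simp [Z, σ, Matrix.mul_apply, Fin.sum_univ_two]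
  let A : Bool → Fin k → Matrix (Fin 2) (Fin 2) ℂ := fun b l =>
    if l = i then hadamardKraus (σ b) else if l = i₀ then Z b else 1
  refine PConv.step (c := fun _ => 2) i Bool A (fun _ => r) ?_ (fun b l hl => ?_) ?_ fun b => ?_
  · have : ‖r‖ ^ 2 = 2⁻¹ := by
      rw [← norm_pow, sq, ofReal_sqrt_two_inv_mul_self]
      norm_num
    rw [Fintype.sum_bool, this]
    norm_num
  · simp only [A, if_neg hl]
    split_ifs
    · exact hZ b
    · exact isContr_one
  · simp only [A, if_true]
    exact isKraus_hadamard
  · have h1 : tensorOp (d := fun _ : Fin k => 2) (A b) *ᵥ Pi.single (fun _ => 0) 1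
        = (∏ l, if l = i then r else 1) • Pi.single (fun _ => 0) 1 := by
      refine tensorOp_mulVec_single (d := fun _ => 2) (e := fun _ => 2) (A b) _ _ _ fun l x => ?_
      by_cases hl : l = i
      · fin_cases x <;> simp [A, hl, hadamardKraus, r]
      · by_cases hl0 : l = i₀
        · subst hl0
          fin_cases x <;> simp [A, hl, Z]
        · fin_cases x <;> simp [A, hl, hl0]
    have h2 : tensorOp (d := fun _ : Fin k => 2) (A b) *ᵥ
          Pi.single (fun l => if l ∈ insert i s then 1 else 0) 1
        = (∏ l, ((if l = i then σ b * r else 1) * if l = i₀ then σ b else 1)) •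
          Pi.single (fun l => if l ∈ s then 1 else 0) 1 := by
      refine tensorOp_mulVec_single (d := fun _ => 2) (e := fun _ => 2) (A b) _ _ _ fun l x => ?_
      by_cases hl : l = i
      · subst hl
        fin_cases x <;> simp [A, hadamardKraus, r, hi, hne.symm]
      · by_cases hl0 : l = i₀
        · subst hl0
          fin_cases x <;> simp [A, hl, Z, h₀]
        · by_cases hs : l ∈ s
          · fin_cases x <;> simp [A, hl, hl0, hs]
          · fin_cases x <;> simp [A, hl, hl0, hs]
    have h3 : tensorOp (d := fun _ : Fin k => 2) (A b) *ᵥ partialGHZ (insert i s)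
        = r • partialGHZ s := by
      rw [partialGHZ, Matrix.mulVec_add, h1, h2, Finset.prod_mul_distrib]
      simp only [Finset.prod_ite_eq', Finset.mem_univ, if_true]
      rw [mul_right_comm, hσ, one_mul, partialGHZ, smul_add]
    rw [h3]
    exact PConv.refl _

/-- All parties but `i` are measured out, with `i` correcting the signs. This leaves `|0⟩ + |1⟩` at
party `i`, a vector of norm `√2`. -/
theorem cls_scalarState_sqrt_two_le (i : Fin k) :
    cls (scalarState k (Real.sqrt 2)) ≤ cls (ghz k 2) := by
  let r : ℂ := ((Real.sqrt 2)⁻¹ : ℝ)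
  have h1 : ∀ s : Finset (Fin k), i ∉ s →
      cls ⟨fun _ => 2, partialGHZ {i}⟩ ≤ cls ⟨fun _ => 2, partialGHZ (insert i s)⟩ := by
    intro s
    induction s using Finset.induction_on with
    | empty => exact fun _ => le_rfl
    | insert j s hj ih =>
      intro hi
      rw [Finset.mem_insert, not_or] at hi
      refine (ih hi.2).trans ((cls_le_iff i).2 ?_)
      rw [Finset.insert_comm]
      refine partialGHZ_insert_pconv (Finset.mem_insert_self i s) ?_
      rw [Finset.mem_insert, not_or]
      exact ⟨Ne.symm hi.1, hj⟩
  have h2 := h1 (Finset.univ.erase i) (Finset.notMem_erase i _)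
  rw [Finset.insert_erase (Finset.mem_univ i), partialGHZ_univ] at h2
  refine le_trans ?_ h2
  -- Party `i` applies the bra `⟨+|` and the others `⟨0|`; the two terms add up to `2 / √2 = √2`.
  let A : Fin k → Matrix (Fin 1) (Fin 2) ℂ := fun l => if l = i then !![r, r] else !![1, 0]
  have hA : ∀ l, IsContr (A l) := by
    intro l
    refine isContr_of_coisometry ?_
    have hr := ofReal_sqrt_two_inv_mul_self
    ext x y
    fin_cases x
    fin_cases y
    simp only [A]
    split_ifs
    · simp [Matrix.mul_apply, Fin.sum_univ_two, r] at hr ⊢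
      rw [hr]
      norm_num
    · simp [Matrix.mul_apply, Fin.sum_univ_two]
  have h3 := cls_le_of_isContr i (d := fun _ => 2) (e := fun _ => 1) A hA (partialGHZ {i})
  have h4 : ∀ a : Idx (fun _ : Fin k => 2), (∀ l, l ≠ i → a l = 0) →
      tensorOp (d := fun _ : Fin k => 2) (e := fun _ => 1) A *ᵥ Pi.single a 1
      = (∏ l, if l = i then r else 1) • Pi.single (fun _ => 0) 1 := by
    intro a ha
    refine tensorOp_mulVec_single (d := fun _ => 2) (e := fun _ => 1) A _ _ _ fun l x => ?_
    by_cases hl : l = i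
    · subst hl
      generalize a l = y
      fin_cases x
      fin_cases y <;> simp [A]
    · rw [ha l hl]
      fin_cases x
      simp [A, hl]
  have h5 : tensorOp (d := fun _ : Fin k => 2) (e := fun _ => 1) A *ᵥ partialGHZ {i}
      = fun _ => ((Real.sqrt 2 : ℝ) : ℂ) := by
    rw [partialGHZ, Matrix.mulVec_add, h4 _ fun _ _ => rfl, h4 _ fun l hl => by simp [hl]]
    funext x
    have hx : x = fun _ => 0 := Subsingleton.elim _ _
    have : ((Real.sqrt 2)⁻¹ : ℝ) + (Real.sqrt 2)⁻¹ = Real.sqrt 2 := by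
      have h := Real.mul_self_sqrt (show (0 : ℝ) ≤ 2 by norm_num)
      have h0 : Real.sqrt 2 ≠ 0 := by positivity
      field_simp
      linarith
    simp only [Finset.prod_ite_eq', Finset.mem_univ, if_true, Pi.add_apply, Pi.smul_apply, hx,
      Pi.single_eq_same, smul_eq_mul, mul_one, r]
    exact_mod_cast this
  rw [h5] at h3
  exact h3

/-! ### The Archimedean property -/

theorem mul_le_mul_of_le (i : Fin k) {a b c d : LUClass k} (h : a ≤ b) (h' : c ≤ d) :
    a * c ≤ b * d := by
  refine (mul_le_mul_right_of_le i a b c h).trans ?_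
  rw [mul_comm b, mul_comm b]
  exact mul_le_mul_right_of_le i c d b h'

theorem pow_le_pow_of_le (i : Fin k) {a b : LUClass k} (h : a ≤ b) (n : ℕ) : a ^ n ≤ b ^ n := by
  induction n with
  | zero => rw [pow_zero, pow_zero]
  | succ n ih =>
    rw [pow_succ, pow_succ]
    exact mul_le_mul_of_le i ih h

/-- Powers of `√2` are unbounded, so `c` is a power of `√2` times a scalar of modulus at most one;
the latter is below `1` and the former below a power of `GHZ_2`. -/
theorem exists_scalarState_le (hk : 1 ≤ k) (c : ℂ) :
    ∃ r : ℕ, cls (scalarState k c) ≤ (r : LUClass k) := by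
  have i : Fin k := ⟨0, hk⟩
  have h1 : (1 : ℝ) < Real.sqrt 2 := by
    rw [Real.lt_sqrt] <;> norm_num
  obtain ⟨n, hn⟩ := pow_unbounded_of_one_lt ‖c‖ h1
  have hpos : (0 : ℝ) < Real.sqrt 2 ^ n := by positivity
  have h0 : ((Real.sqrt 2 : ℝ) : ℂ) ^ n ≠ 0 := by exact_mod_cast hpos.ne'
  refine ⟨2 ^ n, ?_⟩
  have e : c = c / ((Real.sqrt 2 : ℝ) : ℂ) ^ n * ((Real.sqrt 2 : ℝ) : ℂ) ^ n :=
    (div_mul_cancel₀ _ h0).symm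
  have h2 : cls (scalarState k (c / ((Real.sqrt 2 : ℝ) : ℂ) ^ n)) ≤ 1 := by
    refine cls_scalarState_le_one i ?_
    rw [norm_div, norm_pow, Complex.norm_real, Real.norm_eq_abs, abs_of_pos (by positivity),
      div_le_one hpos]
    exact hn.le
  have h3 := cls_scalarState_sqrt_two_le i
  rw [← natCast_eq_cls_ghz hk] at h3
  rw [e, cls_scalarState_mul, cls_scalarState_pow, Nat.cast_pow, ← one_mul ((2 : ℕ) ^ n : LUClass k)]
  exact mul_le_mul_of_le i h2 (pow_le_pow_of_le i h3 n)

/-- A GHZ state with one level per product basis vector is mapped to `v` by local operators. These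
become contractions after rescaling, and the scalar lost is bought back with further GHZ states. -/
theorem exists_le_natCast (hk : 1 ≤ k) (a : LUClass k) : ∃ r : ℕ, a ≤ (r : LUClass k) := by
  classical
  have i : Fin k := ⟨0, hk⟩
  obtain ⟨⟨d, v⟩⟩ := a
  let D := Fintype.card (Idx d)
  let E : Fin D ≃ Idx d := (Fintype.equivFin (Idx d)).symm
  -- Level `z` is sent to the `l`-th index of the `z`-th basis vector; party `i` alone supplies the
  -- coefficient.
  let A : ∀ l, Matrix (Fin (d l)) (Fin D) ℂ := fun l y z =>
    (if l = i then v (E z) else 1) * if y = E z l then 1 else 0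
  have hA : tensorOp A *ᵥ (ghz k D).amp = v := by
    funext x
    rw [tensorOp_mulVec_ghz]
    simp only [A, Finset.prod_mul_distrib, Finset.prod_ite_zero, Finset.prod_ite_eq',
      Finset.mem_univ, if_true, Finset.prod_const_one, forall_const, ← funext_iff]
    rw [E.sum_comp (fun y => v y * if x = y then 1 else 0)]
    simp
  choose t ht hcontr using fun l => exists_isContr_smul (A l)
  have h1 := cls_le_of_isContr i (d := fun _ => D) (fun l => t l • A l) hcontr (ghz k D).amp
  have h2 : tensorOp (fun l => t l • A l) = (∏ l, t l) • tensorOp A := by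
    ext x y
    simp [tensorOp, Finset.prod_mul_distrib]
  have h4 : tensorOp (fun l => t l • A l) *ᵥ (ghz k D).amp = (∏ l, t l) • v := by
    rw [h2]
    exact (Matrix.smul_mulVec _ _ _).trans (congrArg _ hA)
  rw [h4] at h1
  obtain ⟨r, hr⟩ := exists_scalarState_le hk (∏ l, t l)⁻¹
  have h3 : (∏ l, t l) ≠ 0 := Finset.prod_ne_zero_iff.2 fun l _ => ht l
  refine ⟨r * D, ?_⟩
  change cls (⟨d, v⟩ : PureState k) ≤ _
  have e : v = (∏ l, t l)⁻¹ • (∏ l, t l) • v := by rw [smul_smul, inv_mul_cancel₀ h3, one_smul]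
  rw [e, cls_smul, Nat.cast_mul]
  refine mul_le_mul_of_le i hr ?_
  rw [natCast_eq_cls_ghz hk]
  exact h1

/-- Each party projects onto its part of a product basis vector at which the coefficient is nonzero.
-/
theorem exists_scalarState_le_of_ne_zero (i : Fin k) {b : LUClass k} (hb : b ≠ 0) :
    ∃ c : ℂ, c ≠ 0 ∧ cls (scalarState k c) ≤ b := by
  obtain ⟨⟨d, v⟩⟩ := b
  have hv : v ≠ 0 := fun h => hb (cls_eq_zero (ψ := ⟨d, v⟩) h)
  obtain ⟨x, hx⟩ := Function.ne_iff.1 hv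
  refine ⟨v x, hx, ?_⟩
  let A : ∀ l, Matrix (Fin 1) (Fin (d l)) ℂ := fun l =>
    Matrix.of fun _ y => if y = x l then 1 else 0
  have h := cls_le_of_isContr i (d := d) (e := fun _ => 1) A (fun l => isContr_of_coisometry (by
    ext a b
    simp [A, Matrix.mul_apply, Matrix.one_apply, eq_iff_true_of_subsingleton])) v
  have e : tensorOp (e := fun _ => 1) A *ᵥ v = fun _ => v x := by
    funext a
    simp only [A, Matrix.mulVec, dotProduct, tensorOp, Matrix.of_apply, Finset.prod_ite_zero,
      Finset.prod_const_one]
    simp [← funext_iff]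
  rw [e] at h
  exact h

theorem isStrassen (hk : 1 ≤ k) : IsStrassen fun a b : LUClass k => a ≤ b where
  refl := le_refl
  trans _ _ _ := le_trans
  add_right := add_le_add_right_of_le ⟨0, hk⟩
  mul_right := mul_le_mul_right_of_le ⟨0, hk⟩
  zero_le := zero_le_cls ⟨0, hk⟩
  not_succ := not_natCast_succ_le hk
  arch a b hb := by
    have i : Fin k := ⟨0, hk⟩
    obtain ⟨c, hc, hcb⟩ := exists_scalarState_le_of_ne_zero i hb
    obtain ⟨r, hr⟩ := exists_le_natCast hk a
    obtain ⟨s, hs⟩ := exists_scalarState_le hk c⁻¹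
    refine ⟨r * s, ?_⟩
    -- Multiplying `c⁻¹ ≤ s` by `c ≤ b` gives `1 ≤ s * b`, and then `a ≤ r ≤ r * s * b`.
    have h1 := mul_le_mul_of_le i hs hcb
    rw [← cls_scalarState_mul, inv_mul_cancel₀ hc, cls_scalarState_one] at h1
    have h2 := mul_le_mul_of_le i hr h1
    rwa [mul_one, ← mul_assoc, ← Nat.cast_mul] at h2

theorem cls_tensorPow (ψ : PureState k) (n : ℕ) : cls (ψ.tensorPow n) = cls ψ ^ n := by
  induction n with
  | zero => rw [pow_zero]; rfl
  | succ n ih => rw [pow_succ, ← ih]; rfl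

end Order

end LOCC

end

theorem theorem2 (k : ℕ) (hk : 1 ≤ k) :
    -- `(S_k, ⊕, ⊗, ≤)` is a preordered semiring
    (∀ a b c d : LUClass k, a ≤ b → c ≤ d → a + c ≤ b + d ∧ a * c ≤ b * d) ∧
    -- the natural number `d` is the class of the GHZ state, and `≤` is the usual order on `ℕ`
    (∀ d : ℕ, (d : LUClass k) = cls (ghz k d)) ∧
    (∀ m n : ℕ, (m : LUClass k) ≤ (n : LUClass k) ↔ m ≤ n) ∧
    (∀ a b : LUClass k, a ≠ 0 → b ≠ 0 → ∃ r : ℕ, a ≤ (r : LUClass k) * b) ∧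
    -- the asymptotic preorder is asymptotic LOCC convertibility with sublinearly many GHZ states
    (∀ ψ φ : PureState k, AsympLE (cls φ) (cls ψ) ↔
      ∃ x : ℕ → ℕ, ((fun n => (x n : ℝ)) =o[Filter.atTop] fun n : ℕ => (n : ℝ)) ∧
        ∀ n, Converts (((ghz k 2).tensorPow (x n)).tensor (ψ.tensorPow n)) (φ.tensorPow n)) ∧
    -- and it is characterised by the asymptotic LOCC spectrum
    (∀ ψ φ : PureState k, AsympLE (cls φ) (cls ψ) ↔
      ∀ f ∈ asympSpectrum k, f (cls φ) ≤ f (cls ψ)) := by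
  have h := isStrassen hk
  refine ⟨fun a b c d hab hcd => ⟨h.add hab hcd, h.mul hab hcd⟩, natCast_eq_cls_ghz hk,
    fun m n => h.natCast_le_iff, fun a b _ hb => h.arch a b hb, fun ψ φ => ?_,
    fun ψ φ => ⟨?_, fun hf => h.exists_sublinear fun f hmono => hf f fun a b => hmono a b⟩⟩
  · refine exists_congr fun x => and_congr_right fun _ => forall_congr' fun n => ?_
    have h2 : (2 : LUClass k) = cls (ghz k 2) := natCast_eq_cls_ghz hk 2
    rw [h2, ← cls_tensorPow, ← cls_tensorPow, ← cls_tensorPow]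
    rfl
  · rintro ⟨x, hx, hle⟩ f hf
    refine IsStrassen.le_of_sublinear hx fun N => ?_
    have := hf (hle N)
    simpa only [map_mul, map_pow, map_ofNat] using this
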